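/- Fix $d$ and write $\mathbb R^d$ for Euclidean space. Let $P_2(\mathbb R^d)$ be the set of Borel probability measures on $\mathbb R^d$ with finite second moment, and $P_2^{ac}(\mathbb R^d)$ the subset of those that are absolutely continuous with respect to Lebesgue measure. For $\mu,\xi\in P_2(\mathbb R^d)$ write $\mu\le_{\rm cx}\xi$ (convex order) if $\int f\,d\mu\le\int f\,d\xi$ for every convex $f:\mathbb R^d\to\mathbb R$ for which both integrals exist in the extended sense. Put $P^{\rm cx}_{2,\mu\le}=\{\xi\in P_2(\mathbb R^d):\mu\le_{\rm cx}\xi\}$ and $\mathcal T_2(\xi,\nu)=\inf_{\pi\in\Pi(\xi,\nu)}\int|x-y|^2\,d\pi(x,y)$, where $\Pi(\xi,\nu)$ is the set of couplings of $\xi$ and $\nu$. A projection of $\nu$ onto $P^{\rm cx}_{2,\mu\le}$ (a forward convex-order projection of $\nu$) is any $\xi\in P^{\rm cx}_{2,\mu\le}$ with $\mathcal T_2(\xi,\nu)=\inf_{\eta\in P^{\rm cx}_{2,\mu\le}}\mathcal T_2(\eta,\nu)$. For $\psi:\mathbb R^d\to\mathbb R$ let $Q_{\bar 2}(\psi)(y)=\sup_{x\in\mathbb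 R^d}\{\psi(x)-|x-y|^2\}$, and for $g:\mathbb R^d\to\mathbb R$ let $g^*(y)=\sup_{x\in\mathbb R^d}\{x\cdot y-g(x)\}$; both take values in $(-\infty,\infty]$. A proper lower semicontinuous convex function $f:\mathbb R^d\to(-\infty,\infty]$ is called a convex expansion if $f=g^*$ for some continuous $g:\mathbb R^d\to\mathbb R$ with $D^2g\le \mathrm{Id}$ in the sense of distributions. **Theorem.** Let $\mu\in P_2(\mathbb R^d)$ and $\nu\in P_2^{ac}(\mathbb R^d)$. Let $\varphi:\mathbb R^d\to\mathbb R$ be an optimizer of the forward dual problem, that is, $\varphi$ is continuous and convex, $|\varphi(x)|\le C(1+|x|^2)$ for some constant $C$, and $$\int\varphi\,d\mu-\int Q_{\bar 2}(\varphi)\,d\nu=\sup_{\psi}\Big\{\int\psi\,d\mu-\int Q_{\bar 2}(\psi)\,d\nu\Big\},$$ where the supremum runs over all convex $\psi:\mathbb R^d\to\mathbb R$ with at most quadratic growth. Set $\bar\varphi_0(x)=\tfrac12|x|^2-\tfrac12\varphi(x)$. Then: (i) $\bar\varphi_0^*$ is a convex expansion. In addition, $D^2\bar\varphi_0^*\ge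 \mathrm{Id}$ in the sense of distributions on the interior of the set $\{\bar\varphi_0^*<\infty\}$, and $\bar\varphi_0^*$ is uniformly convex with constant $1$: for all $x,y\in\mathbb R^d$ and $t\in(0,1)$, $$\bar\varphi_0^*(tx+(1-t)y)+\tfrac12t(1-t)|x-y|^2\le t\,\bar\varphi_0^*(x)+(1-t)\,\bar\varphi_0^*(y).$$ (ii) At $\nu$-almost every $y$ the function $\bar\varphi_0^*$ is finite in a neighbourhood of $y$ and differentiable at $y$, and $(\nabla\bar\varphi_0^*)_\#\nu$ is the unique projection of $\nu$ onto $P^{\rm cx}_{2,\mu\le}$. -/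

import Mathlib

open MeasureTheory Set
open scoped ENNReal ContDiff

noncomputable section

namespace ConvexOrderProjection

/-- The Euclidean space of dimension `d`. -/
abbrev Rd (d : ℕ) := EuclideanSpace ℝ (Fin d)

variable {d : ℕ}

/-! ### Measures, integrals in the extended sense, transport cost -/

/-- Borel probability measures with finite second moment. -/
def MemP2 (μ : Measure (Rd d)) : Prop :=
  IsProbabilityMeasure μ ∧ ∫⁻ x, ‖x‖ₑ ^ 2 ∂μ < ⊤

/-- Probability measures with finite second moment, absolutely continuous with respect to
Lebesgue measure. -/
def MemP2ac (μ : Measure (Rd d)) : Prop :=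
  MemP2 μ ∧ μ ≪ volume

/-- The integral of `f` exists in the extended sense: its positive or its negative part has a
finite integral. -/
def ExtIntegralExists (μ : Measure (Rd d)) (f : Rd d → EReal) : Prop :=
  ∫⁻ x, (f x).toENNReal ∂μ ≠ ⊤ ∨ ∫⁻ x, (-f x).toENNReal ∂μ ≠ ⊤

/-- The integral in the extended sense, `∫ f⁺ dμ - ∫ f⁻ dμ`. -/
def extIntegral (μ : Measure (Rd d)) (f : Rd d → EReal) : EReal :=
  ((∫⁻ x, (f x).toENNReal ∂μ : ℝ≥0∞) : EReal) - ((∫⁻ x, (-f x).toENNReal ∂μ : ℝ≥0∞) : EReal)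

/-- The couplings of `ξ` and `ν`. -/
def couplings (ξ ν : Measure (Rd d)) : Set (Measure (Rd d × Rd d)) :=
  {π | π.fst = ξ ∧ π.snd = ν}

/-- The quadratic transport cost `inf_π ∫ |x - y|² dπ(x, y)`. -/
def transportCost (ξ ν : Measure (Rd d)) : ℝ≥0∞ :=
  ⨅ π ∈ couplings ξ ν, ∫⁻ p, ‖p.1 - p.2‖ₑ ^ 2 ∂π

/-! ### Convex order, forward cone, forward projection -/

/-- `μ` is smaller than `ν` in convex order. -/
def ConvexOrderLE (μ ν : Measure (Rd d)) : Prop :=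
  ∀ φ : Rd d → ℝ, ConvexOn ℝ univ φ →
    ExtIntegralExists μ (fun x => (φ x : EReal)) → ExtIntegralExists ν (fun x => (φ x : EReal)) →
    extIntegral μ (fun x => (φ x : EReal)) ≤ extIntegral ν (fun x => (φ x : EReal))

/-- The forward convex order cone with vertex `μ`. -/
def forwardCone (μ : Measure (Rd d)) : Set (Measure (Rd d)) :=
  {ξ | MemP2 ξ ∧ ConvexOrderLE μ ξ}

/-- `ξ` is a forward convex order projection of `ν`, i.e. a projection onto the forward cone with
vertex `μ`. -/
def IsForwardProjection (μ ν ξ : Measure (Rd d)) : Prop :=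
  ξ ∈ forwardCone μ ∧ transportCost ξ ν = ⨅ η ∈ forwardCone μ, transportCost η ν

/-! ### Convex functions with values in `(-∞, ∞]` -/

/-- A function is proper if it never takes the value `-∞` and is not identically `∞`. -/
def IsProper (f : Rd d → EReal) : Prop :=
  (∀ x, f x ≠ ⊥) ∧ ∃ x, f x ≠ ⊤

/-- Convexity of an extended-real-valued function: its epigraph is convex. -/
def IsConvex (f : Rd d → EReal) : Prop :=
  Convex ℝ {p : Rd d × ℝ | f p.1 ≤ (p.2 : EReal)}

/-- The class of proper lower semicontinuous convex functions. -/
def convexClass (d : ℕ) : Set (Rd d → EReal) :=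
  {f | IsProper f ∧ IsConvex f ∧ LowerSemicontinuous f}

/-- Uniform convexity with constant `m` of a function with values in `(-∞, ∞]`. -/
def UniformlyConvexWith (m : ℝ) (f : Rd d → EReal) : Prop :=
  ∀ x y : Rd d, ∀ a b : ℝ, 0 < a → 0 < b → a + b = 1 →
    f (a • x + b • y) + ((m / 2 * a * b * ‖x - y‖ ^ 2 : ℝ) : EReal)
      ≤ (a : EReal) * f x + (b : EReal) * f y

/-- The effective domain of a function with values in `(-∞, ∞]`. -/
def effDomain (f : Rd d → EReal) : Set (Rd d) := {y | f y ≠ ⊤}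

/-- The Legendre transform `g*(y) = sup_x (x · y - g x)`. -/
def legendre (g : Rd d → ℝ) (y : Rd d) : EReal :=
  ⨆ x : Rd d, ((inner ℝ x y - g x : ℝ) : EReal)

/-- The pairing of the distributional second derivative `∂_v ∂_v g` with `ψ`. -/
def secondDistDeriv (g : Rd d → ℝ) (v : Rd d) (ψ : Rd d → ℝ) : ℝ :=
  ∫ x, g x * fderiv ℝ (fun z => fderiv ℝ ψ z v) x v

/-- Nonnegative smooth test functions with compact support in `U`. -/
def testFunctions (U : Set (Rd d)) : Set (Rd d → ℝ) :=
  {ψ | ContDiff ℝ ∞ ψ ∧ HasCompactSupport ψ ∧ tsupport ψ ⊆ U ∧ ∀ x, 0 ≤ ψ x}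

/-- `D² g ≤ Id` in the sense of distributions on the open set `U`. -/
def HessianLEId (U : Set (Rd d)) (g : Rd d → ℝ) : Prop :=
  LocallyIntegrableOn g U ∧
    ∀ ψ ∈ testFunctions U, ∀ v : Rd d, secondDistDeriv g v ψ ≤ ‖v‖ ^ 2 * ∫ x, ψ x

/-- `D² g ≥ Id` in the sense of distributions on the open set `U`. -/
def HessianGEId (U : Set (Rd d)) (g : Rd d → ℝ) : Prop :=
  LocallyIntegrableOn g U ∧
    ∀ ψ ∈ testFunctions U, ∀ v : Rd d, ‖v‖ ^ 2 * ∫ x, ψ x ≤ secondDistDeriv g v ψ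

/-- A convex expansion: a proper lower semicontinuous convex function of the form `g*` with
`D² g ≤ Id` in the sense of distributions. Such a `g` agrees almost everywhere with a continuous
real-valued function; the definition asks for this representative, because `g*` depends on the
values of `g` at every point. -/
def IsConvexExpansion (f : Rd d → EReal) : Prop :=
  f ∈ convexClass d ∧ ∃ g : Rd d → ℝ, Continuous g ∧ HessianLEId univ g ∧ f = legendre g

/-! ### The forward dual problem -/

/-- Measurable functions with at most quadratic growth. -/
def Sb2 (d : ℕ) : Set (Rd d → ℝ) :=
  {u | Measurable u ∧ ∃ C : ℝ, ∀ x, |u x| ≤ C * (1 + ‖x‖ ^ 2)}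

/-- Continuous functions with at most quadratic growth. -/
def Cb2 (d : ℕ) : Set (Rd d → ℝ) :=
  {u | Continuous u ∧ ∃ C : ℝ, ∀ x, |u x| ≤ C * (1 + ‖x‖ ^ 2)}

/-- The transform `Q̄₂(φ)(y) = sup_x (φ(x) - |x - y|²)`. -/
def Qbar (φ : Rd d → ℝ) (y : Rd d) : EReal :=
  ⨆ x : Rd d, ((φ x - ‖x - y‖ ^ 2 : ℝ) : EReal)

/-- The dual functional `∫ φ dμ - ∫ Q̄₂(φ) dν`. -/
def dualFunctional (μ ν : Measure (Rd d)) (φ : Rd d → ℝ) : EReal :=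
  extIntegral μ (fun x => (φ x : EReal)) - extIntegral ν (Qbar φ)

/-- The optimal value of the forward dual problem: the supremum of the dual functional over
(real-valued) convex functions with at most quadratic growth. -/
def dualValue (μ ν : Measure (Rd d)) : EReal :=
  ⨆ φ ∈ {φ : Rd d → ℝ | (fun x => (φ x : EReal)) ∈ convexClass d ∧ φ ∈ Sb2 d},
    dualFunctional μ ν φ

/-- `φ` is an optimizer of the forward dual problem: a continuous convex function with at most
quadratic growth at which the dual functional attains the optimal dual value. -/
def IsForwardDualOptimizer (μ ν : Measure (Rd d)) (φ : Rd d → ℝ) : Prop :=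
  (fun x => (φ x : EReal)) ∈ convexClass d ∧ φ ∈ Cb2 d ∧ dualFunctional μ ν φ = dualValue μ ν

/-! ### The optimal map -/

/-- The potential `|x|² / 2 - φ(x) / 2`. -/
def potential (φ : Rd d → ℝ) (x : Rd d) : ℝ := ‖x‖ ^ 2 / 2 - φ x / 2

/-- `f` is differentiable at `y`: it is finite near `y` and differentiable there as a real-valued
function. -/
def IsDifferentiableAt (f : Rd d → EReal) (y : Rd d) : Prop :=
  y ∈ interior (effDomain f) ∧ DifferentiableAt ℝ (fun z => (f z).toReal) y

/-- The gradient of `f`; meaningful at the points where `f` is differentiable in the sense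
of `IsDifferentiableAt`. -/
def grad (f : Rd d → EReal) (y : Rd d) : Rd d := gradient (fun z => (f z).toReal) y

end ConvexOrderProjection

end

open ConvexOrderProjection

open Filter Topology

namespace ConvexOrderProjection

variable {d : ℕ}

/-! ### Suprema of real families in the extended reals -/

/-! Completing the square turns `x · y - potential φ x` into `(φ x - |x - y|²) / 2 + |y|² / 2`.
Hence `legendre (potential φ)` equals `Qbar φ / 2 + |y|² / 2`, and both suprema have the same
maximizers. Writing `x = y + p` shows that `Qbar φ` is a supremum of the convex functions `φ (y + p)
- |p|²` of `y`. So the Legendre transform is `|y|² / 2` plus a convex function, which is uniform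
convexity with constant 1. The distributional Hessian bounds follow by moving symmetric second
differences onto the test function.

Comparison with the competitor 0 makes `Qbar φ` finite ν-almost everywhere. As ν is absolutely
continuous, Rademacher's theorem and the nullity of the boundary of a convex set make the Legendre
transform differentiable ν-almost everywhere. At such points its gradient `T y` attains `Qbar φ y`,
and near-maximizers are close to it (`WellPosedAt`). Danskin's envelope theorem then differentiates
`∫ Qbar ((1 - ε) φ + ε ψ) dν` at `ε = 0+`, with derivative `∫ (ψ - φ) ∘ T dν`
(`le_integral_of_forall_le_integral_Qbar`).

Optimality of φ thus gives `∫ ψ dμ - ∫ φ dμ ≤ ∫ (ψ - φ) ∘ T dν` for convex ψ. Large multiples of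
Lipschitz convex functions yield μ ≤ T_#ν in convex order; ψ = 0 bounds the cost of T by the dual
value. By weak duality no element of the cone costs less, so T_#ν is a projection. For uniqueness,
any projection ξ has the same cost. Weak duality for `φ + ε h`, where h is bounded and continuous
but need not be convex, gives `∫ h dξ ≤ ∫ h ∘ T dν`; using `±h` forces ξ = T_#ν. -/

theorem iSup_coe_ne_top_iff {ι : Type*} {F : ι → ℝ} :
    (⨆ i, (F i : EReal)) ≠ ⊤ ↔ BddAbove (range F) := by
  constructor
  · intro h
    obtain ⟨c, hc⟩ : ∃ c : ℝ, (⨆ i, (F i : EReal)) ≤ c := by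
      induction hs : (⨆ i, (F i : EReal)) with
      | bot => exact ⟨0, bot_le⟩
      | coe r => exact ⟨r, le_rfl⟩
      | top => exact absurd hs h
    refine ⟨c, ?_⟩
    rintro _ ⟨i, rfl⟩
    exact_mod_cast (le_iSup (fun i => (F i : EReal)) i).trans hc
  · rintro ⟨c, hc⟩ h
    have : (⨆ i, (F i : EReal)) ≤ (c : EReal) :=
      iSup_le fun i => by exact_mod_cast hc (mem_range_self i)
    rw [h, top_le_iff] at this
    exact EReal.coe_ne_top c this

theorem iSup_coe_ne_bot {ι : Type*} [Nonempty ι] (F : ι → ℝ) : (⨆ i, (F i : EReal)) ≠ ⊥ := by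
  obtain ⟨i⟩ := ‹Nonempty ι›
  exact ne_bot_of_le_ne_bot (EReal.coe_ne_bot _) (le_iSup (fun i => (F i : EReal)) i)

theorem isLUB_toReal_iSup_coe {ι : Type*} [Nonempty ι] {F : ι → ℝ}
    (h : (⨆ i, (F i : EReal)) ≠ ⊤) : IsLUB (range F) (⨆ i, (F i : EReal)).toReal := by
  have hq := EReal.coe_toReal h (iSup_coe_ne_bot F)
  constructor
  · rintro _ ⟨i, rfl⟩
    have := le_iSup (fun i => (F i : EReal)) i
    rw [← hq] at this
    exact_mod_cast this
  · intro c hc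
    have : (⨆ i, (F i : EReal)) ≤ (c : EReal) :=
      iSup_le fun i => by exact_mod_cast hc (mem_range_self i)
    rw [← hq] at this
    exact_mod_cast this

/-! ### Convexity of real-valued functions and the class of convex functions -/

theorem isConvex_coe_iff {φ : Rd d → ℝ} :
    IsConvex (fun x => (φ x : EReal)) ↔ ConvexOn ℝ univ φ := by
  rw [convexOn_iff_convex_epigraph]
  simp [IsConvex]

theorem coe_mem_convexClass {φ : Rd d → ℝ} (hφ : ConvexOn ℝ univ φ) (hc : Continuous φ) :
    (fun x => (φ x : EReal)) ∈ convexClass d :=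
  ⟨⟨fun _ => EReal.coe_ne_bot _, 0, EReal.coe_ne_top _⟩, isConvex_coe_iff.2 hφ,
    (continuous_coe_real_ereal.comp hc).lowerSemicontinuous⟩

/-! ### The Legendre transform of the potential -/

theorem legendre_ne_bot (g : Rd d → ℝ) (y : Rd d) : legendre g y ≠ ⊥ :=
  iSup_coe_ne_bot _

theorem inner_sub_le_legendre {g : Rd d → ℝ} {y : Rd d} (hy : legendre g y ≠ ⊤) (x : Rd d) :
    inner ℝ x y - g x ≤ (legendre g y).toReal :=
  (isLUB_toReal_iSup_coe hy).1 (mem_range_self x)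

theorem isConvex_legendre (g : Rd d → ℝ) : IsConvex (legendre g) := by
  have : {p : Rd d × ℝ | legendre g p.1 ≤ (p.2 : EReal)}
      = ⋂ x : Rd d, {p : Rd d × ℝ | inner ℝ x p.1 - g x ≤ p.2} := by
    ext p
    simp only [legendre, mem_ofPred_eq, iSup_le_iff, mem_iInter, EReal.coe_le_coe_iff]
  rw [IsConvex, this]
  refine convex_iInter fun x p hp q hq a b ha hb hab => ?_
  simp only [mem_ofPred_eq, Prod.fst_add, Prod.snd_add, Prod.smul_fst, Prod.smul_snd, inner_add_right,
    inner_smul_right, smul_eq_mul] at *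
  have h1 := mul_le_mul_of_nonneg_left hp ha
  have h2 := mul_le_mul_of_nonneg_left hq hb
  have h3 : g x = a * g x + b * g x := by rw [← add_mul, hab, one_mul]
  linarith

theorem lowerSemicontinuous_legendre (g : Rd d → ℝ) : LowerSemicontinuous (legendre g) :=
  lowerSemicontinuous_iSup fun x => Continuous.lowerSemicontinuous <|
    continuous_coe_real_ereal.comp (by fun_prop)

theorem legendre_mem_convexClass {g : Rd d → ℝ} (h : (effDomain (legendre g)).Nonempty) :
    legendre g ∈ convexClass d :=
  ⟨⟨legendre_ne_bot g, h⟩, isConvex_legendre g, lowerSemicontinuous_legendre g⟩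

theorem norm_sq_convexCombination (x y : Rd d) {a b : ℝ} (hab : a + b = 1) :
    ‖a • x + b • y‖ ^ 2 = a * ‖x‖ ^ 2 + b * ‖y‖ ^ 2 - a * b * ‖x - y‖ ^ 2 := by
  rw [norm_add_sq_real, norm_sub_sq_real, norm_smul, norm_smul, inner_smul_left, inner_smul_right,
    mul_pow, mul_pow, Real.norm_eq_abs, Real.norm_eq_abs, sq_abs, sq_abs]
  obtain rfl : b = 1 - a := by linarith
  simp
  ring

/-- The bridge between the two transforms: maximizing in `x` is the same problem for `legendre
(potential φ)` and for `Qbar φ`. -/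
theorem inner_sub_potential (φ : Rd d → ℝ) (x y : Rd d) :
    inner ℝ x y - potential φ x = (φ x - ‖x - y‖ ^ 2) / 2 + ‖y‖ ^ 2 / 2 := by
  rw [potential, norm_sub_sq_real]
  ring

theorem uniformlyConvexWith_legendre_potential {φ : Rd d → ℝ} (hφ : ConvexOn ℝ univ φ) :
    UniformlyConvexWith 1 (legendre (potential φ)) := by
  intro x y a b ha hb hab
  set f := legendre (potential φ) with hf
  by_cases hx : f x = ⊤
  · rw [hx, EReal.coe_mul_top_of_pos ha, EReal.top_add_of_ne_bot]
    · exact le_top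
    · induction hy : f y with
      | bot => exact absurd hy (legendre_ne_bot _ _)
      | coe r => exact_mod_cast EReal.coe_ne_bot (b * r)
      | top => rw [EReal.coe_mul_top_of_pos hb]; simp
  by_cases hy : f y = ⊤
  · rw [hy, EReal.coe_mul_top_of_pos hb, EReal.add_top_of_ne_bot]
    · exact le_top
    · induction hx' : f x with
      | bot => exact absurd hx' (legendre_ne_bot _ _)
      | coe r => exact_mod_cast EReal.coe_ne_bot (a * r)
      | top => exact absurd hx' hx
  have ex := EReal.coe_toReal hx (legendre_ne_bot _ _)
  have ey := EReal.coe_toReal hy (legendre_ne_bot _ _)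
  have key : ∀ w, inner ℝ w (a • x + b • y) - potential φ w
      ≤ a * (f x).toReal + b * (f y).toReal - 1 / 2 * a * b * ‖x - y‖ ^ 2 := by
    intro w
    set z := a • x + b • y with hz
    set p := w - z with hp
    -- Shifting both endpoints by the same `p` leaves `|p|²` as the penalty at `x`, at `y` and at
    -- `z`, so only convexity of `φ` is needed.
    have hw : w = a • (x + p) + b • (y + p) := by
      have : a • p + b • p = p := by rw [← add_smul, hab, one_smul]
      rw [smul_add, smul_add, add_add_add_comm, this, ← hz, hp]
      abel
    have h1 := hφ.2 (mem_univ (x + p)) (mem_univ (y + p)) ha.le hb.le hab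
    rw [← hw, smul_eq_mul, smul_eq_mul] at h1
    have h2 := inner_sub_le_legendre hx (x + p)
    have h3 := inner_sub_le_legendre hy (y + p)
    rw [inner_sub_potential, add_sub_cancel_left] at h2 h3
    rw [inner_sub_potential, ← hp]
    have h4 := norm_sq_convexCombination x y hab
    rw [← hz] at h4
    have h2' := mul_le_mul_of_nonneg_left h2 ha.le
    have h3' := mul_le_mul_of_nonneg_left h3 hb.le
    have h5 : ‖p‖ ^ 2 = a * ‖p‖ ^ 2 + b * ‖p‖ ^ 2 := by rw [← add_mul, hab, one_mul]
    rw [h4, h5]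
    linarith
  have hz : f (a • x + b • y) ≠ ⊤ :=
    iSup_coe_ne_top_iff.2 ⟨_, by rintro _ ⟨w, rfl⟩; exact key w⟩
  have hle := (isLUB_toReal_iSup_coe hz).2 (by rintro _ ⟨w, rfl⟩; exact key w)
  rw [← EReal.coe_toReal hz (legendre_ne_bot _ _), ← ex, ← ey]
  norm_cast
  change (f (a • x + b • y)).toReal ≤ _ at hle
  linarith

/-! ### Effective domains -/

theorem UniformlyConvexWith.toReal {m : ℝ} {f : Rd d → EReal} (hf : UniformlyConvexWith m f)
    (hbot : ∀ x, f x ≠ ⊥) {x y : Rd d} (hx : f x ≠ ⊤) (hy : f y ≠ ⊤) {a b : ℝ} (ha : 0 < a)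
    (hb : 0 < b) (hab : a + b = 1) :
    f (a • x + b • y) ≠ ⊤ ∧ (f (a • x + b • y)).toReal + m / 2 * a * b * ‖x - y‖ ^ 2
      ≤ a * (f x).toReal + b * (f y).toReal := by
  have h := hf x y a b ha hb hab
  rw [← EReal.coe_toReal hx (hbot x), ← EReal.coe_toReal hy (hbot y)] at h
  have hz : f (a • x + b • y) ≠ ⊤ := by
    intro hz
    rw [hz, EReal.top_add_coe, top_le_iff] at h
    exact EReal.coe_ne_top (a * (f x).toReal + b * (f y).toReal) (by exact_mod_cast h)
  refine ⟨hz, ?_⟩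
  rw [← EReal.coe_toReal hz (hbot _)] at h
  exact_mod_cast h

theorem convexOn_toReal_effDomain {m : ℝ} (hm : 0 ≤ m) {f : Rd d → EReal}
    (hf : UniformlyConvexWith m f) (hbot : ∀ x, f x ≠ ⊥) :
    ConvexOn ℝ (effDomain f) (fun x => (f x).toReal) := by
  rw [convexOn_iff_forall_pos]
  refine ⟨convex_iff_forall_pos.2 fun x hx y hy a b ha hb hab =>
    (hf.toReal hbot hx hy ha hb hab).1, fun x hx y hy a b ha hb hab => ?_⟩
  have := (hf.toReal hbot hx hy ha hb hab).2
  have h2 : 0 ≤ m / 2 * a * b * ‖x - y‖ ^ 2 := by positivity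
  simp only [smul_eq_mul]
  linarith

/-! ### Distributional second derivatives -/

/-- The mean value inequality is used twice: for `h' s - s L`, then for the even function `h s + h
(-s) - s² L`, whose derivative is at most `2 ε t` on `[0, t]`. -/
theorem abs_second_difference_sub_le {h h' h'' : ℝ → ℝ} (h1 : ∀ s, HasDerivAt h (h' s) s)
    (h2 : ∀ s, HasDerivAt h' (h'' s) s) {t L ε : ℝ} (ht : 0 ≤ t)
    (hL : ∀ s, |s| ≤ t → |h'' s - L| ≤ ε) :
    |h t + h (-t) - 2 * h 0 - t ^ 2 * L| ≤ 2 * ε * t ^ 2 := by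
  have hε : 0 ≤ ε := (abs_nonneg _).trans (hL 0 (by simpa using ht))
  have hneg : ∀ s, HasDerivAt (fun s => h (-s)) (-h' (-s)) s := fun s => by
    simpa [Function.comp_def] using (h1 (-s)).scomp s (hasDerivAt_neg s)
  have hB : ∀ s ∈ Icc (-t) t, |h' s - s * L - h' 0| ≤ ε * |s| := by
    intro s hs
    have := (convex_Icc (-t) t).norm_image_sub_le_of_norm_hasDerivWithin_le
      (f := fun s => h' s - s * L) (f' := fun s => h'' s - L) (C := ε)
      (fun x _ => by simpa using ((h2 x).fun_sub ((hasDerivAt_id x).mul_const L)).hasDerivWithinAt)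
      (fun x hx => hL x (abs_le.2 hx)) (x := 0) (y := s) ⟨by linarith, ht⟩ hs
    simpa using this
  have hk := (convex_Icc (0 : ℝ) t).norm_image_sub_le_of_norm_hasDerivWithin_le
      (f := fun s => h s + h (-s) - s ^ 2 * L) (f' := fun s => h' s + -h' (-s) - 2 * s * L)
      (C := 2 * ε * t)
      (fun x _ => by
        simpa using ((((h1 x).fun_add (hneg x)).fun_sub ((hasDerivAt_pow 2 x).mul_const L))).hasDerivWithinAt)
      (fun x hx => by
        have a1 := hB x ⟨by linarith [hx.1], hx.2⟩
        have a2 := hB (-x) ⟨by linarith [hx.2], by linarith [hx.1]⟩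
        have e : h' x + -h' (-x) - 2 * x * L
            = (h' x - x * L - h' 0) - (h' (-x) - (-x) * L - h' 0) := by ring
        rw [Real.norm_eq_abs, e]
        refine (abs_sub _ _).trans ?_
        rw [abs_neg] at a2
        rw [abs_of_nonneg hx.1] at a1 a2
        have := mul_le_mul_of_nonneg_left hx.2 hε
        linarith) (x := 0) (y := t) ⟨le_rfl, ht⟩ ⟨ht, le_rfl⟩
  have e : h t + h (-t) - 2 * h 0 - t ^ 2 * L
      = h t + h (-t) - t ^ 2 * L - (h 0 + h (-0) - 0 ^ 2 * L) := by
    rw [neg_zero]; ring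
  rw [e]
  refine hk.trans (le_of_eq ?_)
  rw [sub_zero, Real.norm_eq_abs, abs_of_nonneg ht]
  ring

section SecondDifference

variable {ψ : Rd d → ℝ}

theorem hasDerivAt_comp_line (hψ : ContDiff ℝ ∞ ψ) (x v : Rd d) (s : ℝ) :
    HasDerivAt (fun s : ℝ => ψ (x + s • v)) (fderiv ℝ ψ (x + s • v) v) s := by
  have h1 : HasDerivAt (fun s : ℝ => x + s • v) v s := by
    simpa using ((hasDerivAt_id s).smul_const v).const_add x
  exact ((hψ.differentiable (by simp)).differentiableAt.hasFDerivAt).comp_hasDerivAt s h1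

theorem contDiff_fderiv_apply_const (hψ : ContDiff ℝ ∞ ψ) (v : Rd d) :
    ContDiff ℝ ∞ (fun z => fderiv ℝ ψ z v) :=
  (hψ.fderiv_right (m := ∞) (by simp)).clm_apply contDiff_const

theorem hasCompactSupport_fderiv_apply_const (hc : HasCompactSupport ψ) (v : Rd d) :
    HasCompactSupport (fun z => fderiv ℝ ψ z v) :=
  (hc.fderiv ℝ).comp_left (g := fun L : Rd d →L[ℝ] ℝ => L v) (by simp)

/-- The second derivative is uniformly continuous because of its compact support, so the Taylor
error is uniform in `x`. -/
theorem exists_second_difference_bound (hψ : ContDiff ℝ ∞ ψ) (hc : HasCompactSupport ψ)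
    (v : Rd d) {ε : ℝ} (hε : 0 < ε) :
    ∃ t₀ > 0, ∀ t, 0 ≤ t → t ≤ t₀ → ∀ x,
      |ψ (x + t • v) + ψ (x - t • v) - 2 * ψ x
        - t ^ 2 * fderiv ℝ (fun z => fderiv ℝ ψ z v) x v| ≤ ε * t ^ 2 := by
  have h1 := contDiff_fderiv_apply_const hψ v
  have h2 := contDiff_fderiv_apply_const h1 v
  have hcs := hasCompactSupport_fderiv_apply_const (hasCompactSupport_fderiv_apply_const hc v) v
  obtain ⟨δ, hδ, hu⟩ := Metric.uniformContinuous_iff.1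
    (hcs.uniformContinuous_of_continuous h2.continuous) (ε / 2) (by positivity)
  refine ⟨δ / (2 * (‖v‖ + 1)), by positivity, fun t ht htt x => ?_⟩
  have := abs_second_difference_sub_le (h := fun s => ψ (x + s • v)) (t := t)
    (L := fderiv ℝ (fun z => fderiv ℝ ψ z v) x v) (ε := ε / 2)
    (hasDerivAt_comp_line hψ x v) (hasDerivAt_comp_line h1 x v) ht
    (fun s hs => by
      refine (hu ?_).le
      rw [dist_eq_norm, add_sub_cancel_left, norm_smul, Real.norm_eq_abs]
      calc |s| * ‖v‖ ≤ δ / (2 * (‖v‖ + 1)) * (‖v‖ + 1) := by gcongr <;> linarith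
        _ = δ / 2 := by field_simp
        _ < δ := by linarith)
  simp only [neg_smul, ← sub_eq_add_neg, zero_smul, add_zero] at this
  calc _ ≤ _ := this
    _ = ε * t ^ 2 := by ring

end SecondDifference

/-- Discrete integration by parts, from translation invariance of Lebesgue measure. -/
theorem integral_mul_second_difference {G ψ : Rd d → ℝ} (hG : Integrable G) (hψ : Continuous ψ)
    (hc : HasCompactSupport ψ) (w : Rd d) :
    Integrable (fun x => (G (x + w) + G (x - w) - 2 * G x) * ψ x) ∧
    ∫ x, G x * (ψ (x + w) + ψ (x - w) - 2 * ψ x)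
      = ∫ x, (G (x + w) + G (x - w) - 2 * G x) * ψ x := by
  obtain ⟨C, hC⟩ := hc.exists_bound_of_continuous hψ
  have hG1 := hG.comp_add_right w
  have hG2 := hG.comp_sub_right w
  have i0 : Integrable fun x => G x * ψ x :=
    hG.mul_bdd hψ.aestronglyMeasurable (ae_of_all _ hC)
  have i1 : Integrable fun x => G (x + w) * ψ x :=
    hG1.mul_bdd hψ.aestronglyMeasurable (ae_of_all _ hC)
  have i2 : Integrable fun x => G (x - w) * ψ x :=
    hG2.mul_bdd hψ.aestronglyMeasurable (ae_of_all _ hC)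
  have j1 : Integrable fun x => G x * ψ (x + w) := by simpa using i2.comp_add_right w
  have j2 : Integrable fun x => G x * ψ (x - w) := by simpa using i1.comp_sub_right w
  have e1 : ∫ x, G x * ψ (x + w) = ∫ x, G (x - w) * ψ x := by
    simpa using integral_add_right_eq_self (μ := volume) (fun x => G (x - w) * ψ x) w
  have e2 : ∫ x, G x * ψ (x - w) = ∫ x, G (x + w) * ψ x := by
    simpa using integral_sub_right_eq_self (μ := volume) (fun x => G (x + w) * ψ x) w
  have a1 : (fun x => G x * (ψ (x + w) + ψ (x - w) - 2 * ψ x))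
      = fun x => G x * ψ (x + w) + G x * ψ (x - w) - 2 * (G x * ψ x) := by ext; ring
  have a2 : (fun x => (G (x + w) + G (x - w) - 2 * G x) * ψ x)
      = fun x => G (x + w) * ψ x + G (x - w) * ψ x - 2 * (G x * ψ x) := by ext; ring
  rw [a1, a2]
  refine ⟨(i1.add i2).sub (i0.const_mul 2), ?_⟩
  rw [integral_sub (j1.fun_add j2) (i0.const_mul 2), integral_sub (i1.fun_add i2) (i0.const_mul 2),
    integral_add j1 j2, integral_add i1 i2, e1, e2]
  ring

/-- The pointwise bound on second differences of `G` is integrated against `ψ`, the differences are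
moved onto `ψ`, and division by `t²` leaves `∂_v ∂_v ψ` up to a small error. -/
theorem le_secondDistDeriv_of_second_difference {U : Set (Rd d)} (hU : IsOpen U) {G : Rd d → ℝ}
    (hG : ContinuousOn G U) {v : Rd d} {c : ℝ}
    (h : ∀ x ∈ U, ∀ t : ℝ, x + t • v ∈ U → x - t • v ∈ U →
      c * t ^ 2 ≤ G (x + t • v) + G (x - t • v) - 2 * G x)
    {ψ : Rd d → ℝ} (hψ : ψ ∈ testFunctions U) :
    c * ∫ x, ψ x ≤ secondDistDeriv G v ψ := by
  obtain ⟨hsm, hc, hsub, hpos⟩ := hψ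
  obtain ⟨δ, hδ, hKU⟩ := hc.isCompact.exists_cthickening_subset_open hU hsub
  set K := Metric.cthickening δ (tsupport ψ) with hK
  have hKc : IsCompact K := hc.isCompact.cthickening
  have hKψ : tsupport ψ ⊆ K := Metric.self_subset_cthickening _
  -- `G` is controlled only on `U`; cutting it off to a compact neighbourhood of the support of `ψ`
  -- makes it integrable and changes no value that is used.
  set H : Rd d → ℝ := K.indicator G with hH
  have hHi : Integrable H :=
    ((hG.mono hKU).integrableOn_compact hKc).integrable_indicator hKc.measurableSet
  have h1 := contDiff_fderiv_apply_const hsm v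
  have h2 := contDiff_fderiv_apply_const h1 v
  have hcs := hasCompactSupport_fderiv_apply_const hc v
  have hcs2 := hasCompactSupport_fderiv_apply_const hcs v
  set ψ₂ : Rd d → ℝ := fun x => fderiv ℝ (fun z => fderiv ℝ ψ z v) x v with hψ₂
  have hsupp : tsupport ψ₂ ⊆ K := by
    refine subset_trans ?_ hKψ
    have aux : ∀ f : Rd d → ℝ, tsupport (fun z => fderiv ℝ f z v) ⊆ tsupport f := fun f =>
      (closure_mono (Function.support_comp_subset (g := fun L : Rd d →L[ℝ] ℝ => L v)
        (by simp) (fderiv ℝ f))).trans (tsupport_fderiv_subset ℝ)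
    exact (aux _).trans (aux _)
  have hsd : secondDistDeriv G v ψ = ∫ x, H x * ψ₂ x := by
    refine integral_congr_ae (ae_of_all _ fun x => ?_)
    by_cases hx : x ∈ K
    · simp [hH, hx, hψ₂]
    · have : ψ₂ x = 0 := image_eq_zero_of_notMem_tsupport fun h => hx (hsupp h)
      simp only [hψ₂] at this
      simp [hH, hx, this]
  rw [hsd]
  refine le_of_forall_pos_le_add fun ε hε => ?_
  set M := ∫ x, |H x| with hM
  have hM0 : 0 ≤ M := integral_nonneg fun _ => abs_nonneg _
  -- The Taylor error is integrated against `|H|`, whose mass is `M`; the `+ 1` covers `M = 0`.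
  obtain ⟨t₀, ht₀, hb⟩ := exists_second_difference_bound hsm hc v (ε := ε / (M + 1)) (by positivity)
  set t := min t₀ (δ / (‖v‖ + 1)) with ht
  have htpos : 0 < t := lt_min ht₀ (by positivity)
  have htv : ‖t • v‖ ≤ δ := by
    rw [norm_smul, Real.norm_eq_abs, abs_of_pos htpos]
    calc t * ‖v‖ ≤ δ / (‖v‖ + 1) * (‖v‖ + 1) := by gcongr; exacts [min_le_right _ _, by linarith]
      _ = δ := by field_simp
  obtain ⟨hint, heq⟩ := integral_mul_second_difference hHi hsm.continuous hc (t • v)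
  have hψi : Integrable ψ := hsm.continuous.integrable_of_hasCompactSupport hc
  have hlow : c * t ^ 2 * ∫ x, ψ x
      ≤ ∫ x, (H (x + t • v) + H (x - t • v) - 2 * H x) * ψ x := by
    rw [← integral_const_mul]
    refine integral_mono (hψi.const_mul _) hint fun x => ?_
    by_cases hx : x ∈ tsupport ψ
    · have m1 : x + t • v ∈ K := Metric.mem_cthickening_of_dist_le _ x _ _ hx (by simpa using htv)
      have m2 : x - t • v ∈ K := Metric.mem_cthickening_of_dist_le _ x _ _ hx (by simpa using htv)
      simp only [hH, indicator_of_mem m1, indicator_of_mem m2, indicator_of_mem (hKψ hx)]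
      exact mul_le_mul_of_nonneg_right (h x (hKU (hKψ hx)) t (hKU m1) (hKU m2)) (hpos x)
    · simp [image_eq_zero_of_notMem_tsupport hx]
  obtain ⟨C, hC⟩ := hcs2.exists_bound_of_continuous h2.continuous
  have hi2 : Integrable fun x => H x * ψ₂ x :=
    hHi.mul_bdd h2.continuous.aestronglyMeasurable (ae_of_all _ hC)
  have hup : ∫ x, H x * (ψ (x + t • v) + ψ (x - t • v) - 2 * ψ x)
      ≤ ∫ x, (t ^ 2 * (H x * ψ₂ x) + ε / (M + 1) * t ^ 2 * |H x|) := by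
    have hi3 : Integrable fun x => H x * (ψ (x + t • v) + ψ (x - t • v) - 2 * ψ x) := by
      obtain ⟨C', hC'⟩ := hc.exists_bound_of_continuous hsm.continuous
      have hsc := hsm.continuous
      refine hHi.mul_bdd (c := C' + C' + 2 * C') (by fun_prop) (ae_of_all _ fun x => ?_)
      refine (norm_sub_le _ _).trans (add_le_add ((norm_add_le _ _).trans
        (add_le_add (hC' _) (hC' _))) ?_)
      rw [norm_mul]
      simpa using hC' x
    refine integral_mono hi3 ((hi2.const_mul _).add (hHi.abs.const_mul _)) fun x => ?_
    have hx := hb t htpos.le (min_le_left _ _) x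
    have h3 : H x * (ψ (x + t • v) + ψ (x - t • v) - 2 * ψ x - t ^ 2 * ψ₂ x)
        ≤ |H x| * (ε / (M + 1) * t ^ 2) := by
      refine (le_abs_self _).trans ?_
      rw [abs_mul]
      exact mul_le_mul_of_nonneg_left hx (abs_nonneg _)
    simp only
    linarith
  rw [integral_add (hi2.const_mul _) (hHi.abs.const_mul _), integral_const_mul, integral_const_mul,
    heq] at hup
  have hfin : t ^ 2 * (c * ∫ x, ψ x) ≤ t ^ 2 * ((∫ x, H x * ψ₂ x) + ε / (M + 1) * M) := by
    linarith
  have h4 := le_of_mul_le_mul_left hfin (by positivity)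
  have h5 : ε / (M + 1) * M ≤ ε := by
    rw [div_mul_eq_mul_div, div_le_iff₀ (by positivity)]
    linarith
  linarith

theorem hessianGEId_toReal {f : Rd d → EReal} (hf : UniformlyConvexWith 1 f)
    (hbot : ∀ x, f x ≠ ⊥) :
    HessianGEId (interior (effDomain f)) (fun y => (f y).toReal) := by
  have hcont : ContinuousOn (fun y => (f y).toReal) (interior (effDomain f)) :=
    (convexOn_toReal_effDomain zero_le_one hf hbot).continuousOn_interior
  refine ⟨hcont.locallyIntegrableOn isOpen_interior.measurableSet, fun ψ hψ v =>
    le_secondDistDeriv_of_second_difference isOpen_interior hcont (fun x hx t h1 h2 => ?_) hψ⟩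
  have := (hf.toReal hbot (interior_subset h1) (interior_subset h2) (a := 1 / 2) (b := 1 / 2)
    (by norm_num) (by norm_num) (by norm_num)).2
  have e1 : (1 / 2 : ℝ) • (x + t • v) + (1 / 2 : ℝ) • (x - t • v) = x := by module
  have e2 : x + t • v - (x - t • v) = (2 * t) • v := by module
  rw [e1, e2, norm_smul, mul_pow, Real.norm_eq_abs, sq_abs] at this
  linarith

theorem hessianLEId_potential {φ : Rd d → ℝ} (hφ : ConvexOn ℝ univ φ) (hc : Continuous φ) :
    HessianLEId univ (potential φ) := by
  have hcont : Continuous (potential φ) := by unfold potential; fun_prop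
  refine ⟨hcont.continuousOn.locallyIntegrableOn .univ, fun ψ hψ v => ?_⟩
  -- An upper bound for the potential is a lower bound for its negative `φ / 2 - |x|² / 2`: the
  -- convex part helps, and the parallelogram law evaluates the quadratic part exactly.
  have := le_secondDistDeriv_of_second_difference (G := fun x => -potential φ x) (v := v)
    (c := -‖v‖ ^ 2) isOpen_univ hcont.neg.continuousOn (fun x _ t _ _ => ?_) hψ
  · simp only [secondDistDeriv, neg_mul, integral_neg] at this ⊢
    linarith
  · have h := hφ.2 (mem_univ (x + t • v)) (mem_univ (x - t • v))
      (by norm_num : (0 : ℝ) ≤ 1 / 2) (by norm_num : (0 : ℝ) ≤ 1 / 2) (by norm_num)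
    have e1 : (1 / 2 : ℝ) • (x + t • v) + (1 / 2 : ℝ) • (x - t • v) = x := by module
    rw [e1, smul_eq_mul, smul_eq_mul] at h
    have e2 := parallelogram_law_with_norm ℝ x (t • v)
    have e3 : ‖t • v‖ ^ 2 = t ^ 2 * ‖v‖ ^ 2 := by
      rw [norm_smul, mul_pow, Real.norm_eq_abs, sq_abs]
    simp only [potential]
    linarith

theorem isConvexExpansion_legendre_potential {φ : Rd d → ℝ} (hφ : ConvexOn ℝ univ φ)
    (hc : Continuous φ) (h : (effDomain (legendre (potential φ))).Nonempty) :
    IsConvexExpansion (legendre (potential φ)) :=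
  ⟨legendre_mem_convexClass h, potential φ, by unfold potential; fun_prop,
    hessianLEId_potential hφ hc, rfl⟩

/-! ### Integrals -/

theorem extIntegral_eq_integral {μ : Measure (Rd d)} {F : Rd d → EReal} {u : Rd d → ℝ}
    (hF : ∀ᵐ x ∂μ, F x = u x) (hu : Integrable u μ) :
    extIntegral μ F = ((∫ x, u x ∂μ : ℝ) : EReal) := by
  have e1 : ∫⁻ x, (F x).toENNReal ∂μ = ∫⁻ x, ENNReal.ofReal (u x) ∂μ :=
    lintegral_congr_ae (hF.mono fun x hx => by simp only [hx, EReal.real_coe_toENNReal])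
  have e2 : ∫⁻ x, (-F x).toENNReal ∂μ = ∫⁻ x, ENNReal.ofReal (-u x) ∂μ :=
    lintegral_congr_ae (hF.mono fun x hx => by
      simp only [hx, ← EReal.coe_neg, EReal.real_coe_toENNReal])
  have n1 : ∫⁻ x, ENNReal.ofReal (u x) ∂μ ≠ ⊤ := (hu.lintegral_lt_top).ne
  have n2 : ∫⁻ x, ENNReal.ofReal (-u x) ∂μ ≠ ⊤ := (hu.neg.lintegral_lt_top).ne
  rw [extIntegral, e1, e2, integral_eq_lintegral_pos_part_sub_lintegral_neg_part hu, EReal.coe_sub,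
    EReal.coe_ennreal_toReal n1, EReal.coe_ennreal_toReal n2]

theorem extIntegralExists_coe {μ : Measure (Rd d)} {u : Rd d → ℝ} (hu : Integrable u μ) :
    ExtIntegralExists μ (fun x => (u x : EReal)) := by
  left
  simp only [EReal.real_coe_toENNReal]
  exact hu.lintegral_lt_top.ne

theorem MemP2.integrable_norm_sq {μ : Measure (Rd d)} (hμ : MemP2 μ) :
    Integrable (fun x => ‖x‖ ^ 2) μ := by
  refine ⟨by fun_prop, ?_⟩
  rw [hasFiniteIntegral_iff_enorm]
  simpa [enorm_pow] using hμ.2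

theorem memP2_of_integrable_norm_sq {μ : Measure (Rd d)} [IsProbabilityMeasure μ]
    (h : Integrable (fun x => ‖x‖ ^ 2) μ) : MemP2 μ := by
  refine ⟨inferInstance, ?_⟩
  have := h.2
  rw [hasFiniteIntegral_iff_enorm] at this
  simpa [enorm_pow] using this

theorem MemP2.integrable_of_mem_Cb2 {μ : Measure (Rd d)} (hμ : MemP2 μ) {u : Rd d → ℝ}
    (hu : u ∈ Cb2 d) : Integrable u μ := by
  obtain ⟨hc, C, hC⟩ := hu
  have := hμ.1
  exact (((integrable_const (1 : ℝ)).add hμ.integrable_norm_sq).const_mul C).mono'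
    hc.aestronglyMeasurable (ae_of_all _ hC)

theorem Cb2_subset_Sb2 : Cb2 d ⊆ Sb2 d := fun _ h => ⟨h.1.measurable, h.2⟩

theorem mem_Cb2_zero : (fun _ => 0 : Rd d → ℝ) ∈ Cb2 d :=
  ⟨continuous_const, 0, by simp⟩

theorem mem_Cb2_const_mul {u : Rd d → ℝ} (hu : u ∈ Cb2 d) (a : ℝ) : (fun x => a * u x) ∈ Cb2 d := by
  obtain ⟨hc, C, hC⟩ := hu
  refine ⟨by fun_prop, |a| * C, fun x => ?_⟩
  rw [abs_mul, mul_assoc]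
  exact mul_le_mul_of_nonneg_left (hC x) (abs_nonneg a)

theorem mem_Cb2_add {u w : Rd d → ℝ} (hu : u ∈ Cb2 d) (hw : w ∈ Cb2 d) :
    (fun x => u x + w x) ∈ Cb2 d := by
  obtain ⟨hc, C, hC⟩ := hu
  obtain ⟨hc', C', hC'⟩ := hw
  refine ⟨by fun_prop, C + C', fun x => ?_⟩
  rw [add_mul]
  exact (abs_add_le _ _).trans (add_le_add (hC x) (hC' x))

theorem mem_Cb2_of_lipschitz {u : Rd d → ℝ} {K : NNReal} (hu : LipschitzWith K u) : u ∈ Cb2 d := by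
  refine ⟨hu.continuous, |u 0| + K, fun x => ?_⟩
  have h1 := hu.dist_le_mul x 0
  rw [Real.dist_eq, dist_zero_right] at h1
  have h2 : |u x| ≤ |u x - u 0| + |u 0| := by simpa using abs_add_le (u x - u 0) (u 0)
  have h3 : ‖x‖ ≤ 1 + ‖x‖ ^ 2 := by nlinarith [sq_nonneg (‖x‖ - 1)]
  have h4 := mul_le_mul_of_nonneg_left h3 K.coe_nonneg
  have h5 : 0 ≤ |u 0| * ‖x‖ ^ 2 := by positivity
  nlinarith

/-! ### The transform `Qbar` -/

theorem Qbar_ne_bot (φ : Rd d → ℝ) (y : Rd d) : Qbar φ y ≠ ⊥ := iSup_coe_ne_bot _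

theorem sub_le_toReal_Qbar {φ : Rd d → ℝ} {y : Rd d} (hy : Qbar φ y ≠ ⊤) (x : Rd d) :
    φ x - ‖x - y‖ ^ 2 ≤ (Qbar φ y).toReal :=
  (isLUB_toReal_iSup_coe hy).1 (mem_range_self x)

theorem toReal_Qbar_le {φ : Rd d → ℝ} {y : Rd d} {c : ℝ} (h : ∀ x, φ x - ‖x - y‖ ^ 2 ≤ c) :
    Qbar φ y ≠ ⊤ ∧ (Qbar φ y).toReal ≤ c := by
  have hy : Qbar φ y ≠ ⊤ := iSup_coe_ne_top_iff.2 ⟨c, by rintro _ ⟨x, rfl⟩; exact h x⟩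
  exact ⟨hy, (isLUB_toReal_iSup_coe hy).2 (by rintro _ ⟨x, rfl⟩; exact h x)⟩

theorem le_toReal_Qbar {φ : Rd d → ℝ} {y : Rd d} (hy : Qbar φ y ≠ ⊤) :
    φ y ≤ (Qbar φ y).toReal := by
  simpa using sub_le_toReal_Qbar hy y

theorem measurable_Qbar {φ : Rd d → ℝ} : Measurable (Qbar φ) :=
  (lowerSemicontinuous_iSup fun x => Continuous.lowerSemicontinuous <|
    continuous_coe_real_ereal.comp (by fun_prop)).measurable

/-- `Qbar φ` is `ν`-almost everywhere finite and `ν`-integrable. -/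
def QbarIntegrable (ν : Measure (Rd d)) (φ : Rd d → ℝ) : Prop :=
  (∀ᵐ y ∂ν, Qbar φ y ≠ ⊤) ∧ Integrable (fun y => (Qbar φ y).toReal) ν

/-- Choosing `x = y` in the supremum gives `φ ≤ Qbar φ`, so a lower bound on `φ` suffices. -/
theorem qbarIntegrable_of_le {ν : Measure (Rd d)} {φ lo up : Rd d → ℝ} (hlo : Integrable lo ν)
    (hup : Integrable up ν) (h1 : ∀ᵐ y ∂ν, ∀ x, φ x - ‖x - y‖ ^ 2 ≤ up y)
    (h2 : ∀ y, lo y ≤ φ y) : QbarIntegrable ν φ := by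
  refine ⟨h1.mono fun y hy => (toReal_Qbar_le hy).1, ?_⟩
  refine integrable_of_le_of_le measurable_Qbar.ereal_toReal.aestronglyMeasurable
    (h1.mono fun y hy => ?_) (h1.mono fun y hy => (toReal_Qbar_le hy).2) hlo hup
  exact (h2 y).trans (le_toReal_Qbar (toReal_Qbar_le hy).1)

theorem QbarIntegrable.extIntegral_eq {ν : Measure (Rd d)} {φ : Rd d → ℝ}
    (h : QbarIntegrable ν φ) :
    extIntegral ν (Qbar φ) = ((∫ y, (Qbar φ y).toReal ∂ν : ℝ) : EReal) :=
  extIntegral_eq_integral (h.1.mono fun _ hy => (EReal.coe_toReal hy (Qbar_ne_bot _ _)).symm) h.2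

theorem QbarIntegrable.convexCombination {ν : Measure (Rd d)} (hν : MemP2 ν) {φ ψ : Rd d → ℝ}
    (hφ : φ ∈ Cb2 d) (hψ : ψ ∈ Cb2 d) (h1 : QbarIntegrable ν φ) (h2 : QbarIntegrable ν ψ)
    {ε : ℝ} (h0 : 0 ≤ ε) (hε : ε ≤ 1) : QbarIntegrable ν (fun x => (1 - ε) * φ x + ε * ψ x) := by
  refine qbarIntegrable_of_le
    (hν.integrable_of_mem_Cb2 (mem_Cb2_add (mem_Cb2_const_mul hφ (1 - ε)) (mem_Cb2_const_mul hψ ε)))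
    ((h1.2.const_mul (1 - ε)).add (h2.2.const_mul ε)) ?_ (fun _ => le_rfl)
  filter_upwards [h1.1, h2.1] with y hy1 hy2 x
  have a1 := mul_le_mul_of_nonneg_left (sub_le_toReal_Qbar hy1 x) (sub_nonneg.2 hε)
  have a2 := mul_le_mul_of_nonneg_left (sub_le_toReal_Qbar hy2 x) h0
  simp only [Pi.add_apply]
  linarith

theorem Qbar_zero (y : Rd d) : Qbar (fun _ => 0) y = 0 := by
  refine le_antisymm (iSup_le fun x => ?_) ?_
  · exact_mod_cast (by simp : (0 : ℝ) - ‖x - y‖ ^ 2 ≤ 0)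
  · refine le_trans ?_ (le_iSup _ y)
    simp

theorem qbarIntegrable_zero (ν : Measure (Rd d)) : QbarIntegrable ν (fun _ => 0) := by
  simp [QbarIntegrable, Qbar_zero]

theorem qbarIntegrable_of_lipschitz {ν : Measure (Rd d)} (hν : MemP2 ν) {h : Rd d → ℝ}
    {K : NNReal} (hh : LipschitzWith K h) : QbarIntegrable ν h := by
  have := hν.1
  have hi := hν.integrable_of_mem_Cb2 (mem_Cb2_of_lipschitz hh)
  refine qbarIntegrable_of_le hi (hi.add (integrable_const ((K : ℝ) ^ 2 / 4)))
    (ae_of_all _ fun y x => ?_) (fun _ => le_rfl)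
  have h1 := (le_abs_self _).trans (hh.dist_le_mul x y)
  rw [dist_eq_norm] at h1
  simp only [Pi.add_apply]
  -- `K r - r² ≤ K² / 4` with `r = |x - y|`.
  nlinarith [sq_nonneg ((K : ℝ) / 2 - ‖x - y‖)]

theorem QbarIntegrable.add_bounded {ν : Measure (Rd d)} (hν : MemP2 ν) {φ h : Rd d → ℝ}
    (hφ : φ ∈ Cb2 d) (h1 : QbarIntegrable ν φ) {M : ℝ} (hM : ∀ x, |h x| ≤ M) :
    QbarIntegrable ν (fun x => φ x + h x) := by
  have := hν.1
  refine qbarIntegrable_of_le ((hν.integrable_of_mem_Cb2 hφ).sub (integrable_const M))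
    (h1.2.add (integrable_const M)) ?_ (fun y => ?_)
  · filter_upwards [h1.1] with y hy x
    have := sub_le_toReal_Qbar hy x
    have := (le_abs_self _).trans (hM x)
    simp only [Pi.add_apply]
    linarith
  · have := (neg_le_abs _).trans (hM y)
    simp only [Pi.sub_apply]
    linarith

/-! ### Well-posed maximization and the envelope theorem -/

/-- The maximization of `φ x - ‖x - y‖ ^ 2` is well posed with maximizer `p`: near-maximizers are
close to `p`. -/
structure WellPosedAt (φ : Rd d → ℝ) (y p : Rd d) : Prop where
  ne_top : Qbar φ y ≠ ⊤
  eq : φ p - ‖p - y‖ ^ 2 = (Qbar φ y).toReal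
  close : ∀ δ > 0, ∃ η > 0, ∀ x, (Qbar φ y).toReal - η ≤ φ x - ‖x - y‖ ^ 2 → ‖x - p‖ ≤ δ

/-- Upper half of the envelope theorem. Near `p`, continuity controls `ψ - φ`; away from `p`, a
point loses at least `η` in the problem for `φ`, more than a perturbation of order `ε` can recover.
-/
theorem WellPosedAt.eventually_le {φ ψ : Rd d → ℝ} (hφ : Continuous φ) (hψ : Continuous ψ)
    {y p : Rd d} (h : WellPosedAt φ y p) (hy : Qbar ψ y ≠ ⊤) {δ : ℝ} (hδ : 0 < δ) :
    ∀ᶠ ε in 𝓝[>] (0 : ℝ), (Qbar (fun x => (1 - ε) * φ x + ε * ψ x) y).toReal - (Qbar φ y).toReal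
      ≤ ε * (ψ p - φ p + δ) := by
  obtain ⟨r, hr, hrp⟩ := Metric.continuous_iff.1 (hψ.sub hφ) p δ hδ
  obtain ⟨η, hη, hclose⟩ := h.close (r / 2) (by positivity)
  set k := (Qbar φ y).toReal with hk
  set q := (Qbar ψ y).toReal with hq
  -- This is `(1 - ε) (k - η) + ε q < k + ε (ψ p - φ p + δ)`, the bound needed away from `p`.
  have hev : ∀ᶠ ε in 𝓝[>] (0 : ℝ), ε * (η + q - k - (ψ p - φ p + δ)) < η := by
    have : Tendsto (fun ε : ℝ => ε * (η + q - k - (ψ p - φ p + δ))) (𝓝[>] 0) (𝓝 0) := by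
      refine Tendsto.mono_left ?_ nhdsWithin_le_nhds
      exact Continuous.tendsto' (by fun_prop) _ _ (by simp)
    exact this.eventually (gt_mem_nhds hη)
  have hev1 : ∀ᶠ ε in 𝓝[>] (0 : ℝ), ε < 1 := nhdsWithin_le_nhds (gt_mem_nhds one_pos)
  filter_upwards [hev, hev1, self_mem_nhdsWithin] with ε h1 h2 h3
  rw [sub_le_iff_le_add]
  refine (toReal_Qbar_le fun x => ?_).2
  have a1 := sub_le_toReal_Qbar h.ne_top x
  have a2 := mul_le_mul_of_nonneg_left (sub_le_toReal_Qbar hy x) (le_of_lt h3)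
  by_cases hx : k - η ≤ φ x - ‖x - y‖ ^ 2
  · have hd := hrp x (by rw [dist_eq_norm]; linarith [hclose x hx])
    rw [Real.dist_eq] at hd
    have a3 : ψ x - φ x ≤ ψ p - φ p + δ := by
      have := (le_abs_self _).trans hd.le
      simp only [Pi.sub_apply] at this
      linarith
    have a4 := mul_le_mul_of_nonneg_left a3 (le_of_lt h3)
    linarith
  · have a3 := mul_le_mul_of_nonneg_left (not_le.1 hx).le (sub_nonneg.2 h2.le)
    linarith

theorem WellPosedAt.le_sub {φ ψ : Rd d → ℝ} {y p : Rd d} (h : WellPosedAt φ y p)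
    {ε : ℝ} (hy : Qbar (fun x => (1 - ε) * φ x + ε * ψ x) y ≠ ⊤) :
    ε * (ψ p - φ p) ≤
      (Qbar (fun x => (1 - ε) * φ x + ε * ψ x) y).toReal - (Qbar φ y).toReal := by
  have := sub_le_toReal_Qbar hy p
  rw [← h.eq]
  linarith

/-- The difference quotients `G n` tend to `(ψ - φ) ∘ T` and, by convexity of `Qbar` in its
argument, lie below the integrable `B`. Fatou's lemma for `B - G n` passes to the limit and yields
integrability as well. The constant `c` is free, so that both dual optimality and weak duality can
supply it. -/
theorem le_integral_of_forall_le_integral_Qbar {ν : Measure (Rd d)} (hν : MemP2 ν)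
    {φ ψ : Rd d → ℝ} (hφ : φ ∈ Cb2 d) (hψ : ψ ∈ Cb2 d) (hφi : QbarIntegrable ν φ)
    (hψi : QbarIntegrable ν ψ) {T : Rd d → Rd d} (hT : Measurable T)
    (hwp : ∀ᵐ y ∂ν, WellPosedAt φ y (T y)) {c : ℝ}
    (hc : ∀ ε : ℝ, 0 < ε → ε < 1 → ε * c ≤
      ∫ y, (Qbar (fun x => (1 - ε) * φ x + ε * ψ x) y).toReal ∂ν - ∫ y, (Qbar φ y).toReal ∂ν) :
    Integrable (fun y => ψ (T y) - φ (T y)) ν ∧ c ≤ ∫ y, (ψ (T y) - φ (T y)) ∂ν := by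
  have := hν.1
  -- The shift by 2 keeps `ε 0` strictly below 1.
  set ε : ℕ → ℝ := fun n => 1 / ((n : ℝ) + 2) with hεdef
  have hε0 : ∀ n, 0 < ε n := fun n => by positivity
  have hε1 : ∀ n, ε n < 1 := fun n => by
    rw [hεdef]
    simp only
    rw [div_lt_one (by positivity)]
    linarith [(Nat.cast_nonneg n : (0 : ℝ) ≤ n)]
  have hεt : Tendsto ε atTop (𝓝[>] 0) := by
    refine tendsto_nhdsWithin_iff.2 ⟨?_, Eventually.of_forall hε0⟩
    have := (tendsto_one_div_add_atTop_nhds_zero_nat (𝕜 := ℝ)).comp (tendsto_add_atTop_nat 1)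
    refine this.congr fun n => ?_
    simp only [Function.comp_apply, hεdef, Nat.cast_add, Nat.cast_one]
    ring_nf
  set k : ℕ → Rd d → ℝ := fun n y => (Qbar (fun x => (1 - ε n) * φ x + ε n * ψ x) y).toReal with hk
  have hki : ∀ n, QbarIntegrable ν (fun x => (1 - ε n) * φ x + ε n * ψ x) := fun n =>
    QbarIntegrable.convexCombination hν hφ hψ hφi hψi (hε0 n).le (hε1 n).le
  set G : ℕ → Rd d → ℝ := fun n y => (k n y - (Qbar φ y).toReal) / ε n with hG
  set B : Rd d → ℝ := fun y => (Qbar ψ y).toReal - (Qbar φ y).toReal with hB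
  have hBi : Integrable B ν := hψi.2.sub hφi.2
  have hGi : ∀ n, Integrable (G n) ν := fun n => ((hki n).2.sub hφi.2).div_const _
  have hBGi : ∀ n, Integrable (fun y => B y - G n y) ν := fun n => hBi.sub (hGi n)
  have hcG : ∀ n, c ≤ ∫ y, G n y ∂ν := fun n => by
    have := hc (ε n) (hε0 n) (hε1 n)
    rw [hG]
    simp only
    rw [integral_div, integral_sub (hki n).2 hφi.2, le_div_iff₀ (hε0 n)]
    linarith
  have hGB : ∀ᵐ y ∂ν, ∀ n, G n y ≤ B y := by
    filter_upwards [hφi.1, hψi.1] with y h1 h2 n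
    rw [hG]
    simp only
    rw [div_le_iff₀ (hε0 n), sub_le_iff_le_add]
    refine (toReal_Qbar_le fun x => ?_).2
    have a1 := mul_le_mul_of_nonneg_left (sub_le_toReal_Qbar h1 x) (sub_nonneg.2 (hε1 n).le)
    have a2 := mul_le_mul_of_nonneg_left (sub_le_toReal_Qbar h2 x) (hε0 n).le
    simp only [hB]
    linarith
  have hGt : ∀ᵐ y ∂ν, Tendsto (fun n => G n y) atTop (𝓝 (ψ (T y) - φ (T y))) := by
    filter_upwards [hwp, hψi.1, ae_all_iff.2 fun n => (hki n).1] with y h1 h2 h3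
    refine tendsto_order.2 ⟨fun a ha => Eventually.of_forall fun n => ha.trans_le ?_,
      fun a ha => ?_⟩
    · have := h1.le_sub (h3 n)
      rw [hG]
      simp only
      rw [le_div_iff₀ (hε0 n)]
      linarith
    · have := hεt.eventually
        (h1.eventually_le hφ.1 hψ.1 h2 (δ := (a - (ψ (T y) - φ (T y))) / 2) (by linarith))
      filter_upwards [this] with n hn
      rw [hG]
      simp only
      rw [div_lt_iff₀ (hε0 n)]
      refine lt_of_le_of_lt hn ?_
      rw [mul_comm]
      exact mul_lt_mul_of_pos_right (by linarith) (hε0 n)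
  set S : Rd d → ℝ := fun y => ψ (T y) - φ (T y) with hS
  have hSm : Measurable S := (hψ.1.measurable.comp hT).sub (hφ.1.measurable.comp hT)
  have hSB : ∀ᵐ y ∂ν, S y ≤ B y := by
    filter_upwards [hGt, hGB] with y h1 h2
    exact le_of_tendsto' h1 h2
  have hBc : 0 ≤ ∫ y, B y ∂ν - c := by
    have := integral_mono_ae (hGi 0) hBi (hGB.mono fun y hy => hy 0)
    linarith [hcG 0]
  have hlint : ∫⁻ y, ENNReal.ofReal (B y - S y) ∂ν ≤ ENNReal.ofReal (∫ y, B y ∂ν - c) := by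
    calc ∫⁻ y, ENNReal.ofReal (B y - S y) ∂ν
        = ∫⁻ y, liminf (fun n => ENNReal.ofReal (B y - G n y)) atTop ∂ν := by
          refine lintegral_congr_ae (hGt.mono fun y hy => ?_)
          exact (ENNReal.tendsto_ofReal (hy.const_sub (B y))).liminf_eq.symm
      _ ≤ liminf (fun n => ∫⁻ y, ENNReal.ofReal (B y - G n y) ∂ν) atTop :=
          lintegral_liminf_le' fun n => (hBGi n).aestronglyMeasurable.aemeasurable.ennreal_ofReal
      _ ≤ liminf (fun _ : ℕ => ENNReal.ofReal (∫ y, B y ∂ν - c)) atTop := by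
          refine liminf_le_liminf (Eventually.of_forall fun n => ?_)
          rw [← ofReal_integral_eq_lintegral_ofReal (hBGi n)
            (hGB.mono fun y hy => sub_nonneg.2 (hy n))]
          refine ENNReal.ofReal_le_ofReal ?_
          rw [integral_sub hBi (hGi n)]
          linarith [hcG n]
      _ = _ := by simp
  have hBSi : Integrable (fun y => B y - S y) ν := by
    refine ⟨hBi.aestronglyMeasurable.sub hSm.aestronglyMeasurable, ?_⟩
    rw [hasFiniteIntegral_iff_ofReal (hSB.mono fun y hy => sub_nonneg.2 hy)]
    exact hlint.trans_lt ENNReal.ofReal_lt_top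
  have hSi : Integrable S ν := by
    have := hBi.sub hBSi
    refine this.congr (ae_of_all _ fun y => ?_)
    simp
  refine ⟨hSi, ?_⟩
  rw [← ofReal_integral_eq_lintegral_ofReal hBSi (hSB.mono fun y hy => sub_nonneg.2 hy),
    ENNReal.ofReal_le_ofReal_iff hBc, integral_sub hBi hSi] at hlint
  linarith

/-! ### Differentiability of the conjugate potential -/

theorem toReal_legendre_potential {φ : Rd d → ℝ} {y : Rd d}
    (hy : legendre (potential φ) y ≠ ⊤) :
    Qbar φ y ≠ ⊤ ∧
      (legendre (potential φ) y).toReal = (Qbar φ y).toReal / 2 + ‖y‖ ^ 2 / 2 := by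
  have h1 := toReal_Qbar_le (φ := φ) (y := y)
    (c := 2 * (legendre (potential φ) y).toReal - ‖y‖ ^ 2) fun x => by
      have := inner_sub_le_legendre hy x
      rw [inner_sub_potential] at this
      linarith
  refine ⟨h1.1, le_antisymm ?_ (by linarith [h1.2])⟩
  refine (isLUB_toReal_iSup_coe hy).2 ?_
  rintro _ ⟨x, rfl⟩
  simp only
  rw [inner_sub_potential]
  linarith [sub_le_toReal_Qbar h1.1 x]

theorem legendre_potential_ne_top {φ : Rd d → ℝ} {y : Rd d} (hy : Qbar φ y ≠ ⊤) :
    legendre (potential φ) y ≠ ⊤ := by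
  refine iSup_coe_ne_top_iff.2 ⟨(Qbar φ y).toReal / 2 + ‖y‖ ^ 2 / 2, ?_⟩
  rintro _ ⟨x, rfl⟩
  simp only
  rw [inner_sub_potential]
  linarith [sub_le_toReal_Qbar hy x]

/-- At a point of differentiability of a Legendre transform, near-maximizers are close to the
gradient. -/
theorem exists_norm_sub_grad_le {g : Rd d → ℝ} {y : Rd d}
    (hy : IsDifferentiableAt (legendre g) y) {δ : ℝ} (hδ : 0 < δ) :
    ∃ η > 0, ∀ x, (legendre g y).toReal - η ≤ inner ℝ x y - g x →
      ‖x - grad (legendre g) y‖ ≤ δ := by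
  set p := grad (legendre g) y with hp
  have hgrad : HasGradientAt (fun z => (legendre g z).toReal) p y := hy.2.hasGradientAt
  have hlo := (hasGradientAt_iff_isLittleO.1 hgrad).bound (half_pos hδ)
  obtain ⟨r, hr, hball⟩ := Metric.eventually_nhds_iff.1
    (hlo.and (mem_interior_iff_mem_nhds.1 hy.1))
  refine ⟨δ / 2 * (r / 2), by positivity, fun x hx => ?_⟩
  by_cases hxp : x - p = 0
  · simp [hxp, hδ.le]
  have hn : 0 < ‖x - p‖ := norm_pos_iff.2 hxp
  -- Young's inequality is tested at `y + h`, with `h` pointing along `x - p`. The defect `η` and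
  -- the differentiability error are each `δ r / 4`, which together give `(r / 2) |x - p| ≤ (r / 2)
  -- δ`.
  set h : Rd d := (r / 2 / ‖x - p‖) • (x - p) with hh
  have hhn : ‖h‖ = r / 2 := by
    rw [hh, norm_smul, Real.norm_eq_abs, abs_of_pos (by positivity)]
    field_simp
  obtain ⟨h1, h2⟩ := hball (y := y + h) (by rw [dist_eq_norm, add_sub_cancel_left, hhn]; linarith)
  have h3 := inner_sub_le_legendre h2 x
  rw [add_sub_cancel_left, hhn] at h1
  have h4 := (le_abs_self _).trans h1
  rw [inner_add_right] at h3
  have h5 : inner ℝ (x - p) h = r / 2 * ‖x - p‖ := by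
    rw [hh, inner_smul_right, real_inner_self_eq_norm_sq]
    field_simp
  rw [inner_sub_left] at h5
  have h6 : r / 2 * ‖x - p‖ ≤ r / 2 * δ := by linarith
  exact le_of_mul_le_mul_left h6 (by positivity)

theorem IsDifferentiableAt.wellPosedAt {φ : Rd d → ℝ} (hφ : Continuous φ) {y : Rd d}
    (hy : IsDifferentiableAt (legendre (potential φ)) y) :
    WellPosedAt φ y (grad (legendre (potential φ)) y) := by
  have hfin : legendre (potential φ) y ≠ ⊤ := interior_subset hy.1
  obtain ⟨hq, heq⟩ := toReal_legendre_potential hfin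
  set p := grad (legendre (potential φ)) y with hp
  have hclose : ∀ δ > 0, ∃ η > 0, ∀ x, (Qbar φ y).toReal - η ≤ φ x - ‖x - y‖ ^ 2 →
      ‖x - p‖ ≤ δ := by
    intro δ hδ
    obtain ⟨η, hη, h⟩ := exists_norm_sub_grad_le hy hδ
    refine ⟨2 * η, by positivity, fun x hx => h x ?_⟩
    rw [inner_sub_potential, heq]
    linarith
  refine ⟨hq, le_antisymm (sub_le_toReal_Qbar hq p) ?_, hclose⟩
  -- If `p` missed the supremum, continuity would keep the values near `p` below some `m` smaller
  -- than it, although near-maximizers exist and lie near `p`.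
  by_contra! hlt
  obtain ⟨m, hm1, hm2⟩ := exists_between hlt
  have hcont : Continuous fun x => φ x - ‖x - y‖ ^ 2 := by fun_prop
  obtain ⟨r, hr, hball⟩ := Metric.eventually_nhds_iff.1
    (hcont.continuousAt.eventually (gt_mem_nhds hm1))
  obtain ⟨η, hη, h⟩ := hclose (r / 2) (by positivity)
  obtain ⟨_, ⟨x, rfl⟩, hx, -⟩ := (isLUB_toReal_iSup_coe hq).exists_between
    (sub_lt_self (Qbar φ y).toReal (lt_min hη (sub_pos.2 hm2)))
  change (Qbar φ y).toReal - _ < φ x - ‖x - y‖ ^ 2 at hx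
  have h1 := h x (by linarith [min_le_left η ((Qbar φ y).toReal - m)])
  have h2 : φ x - ‖x - y‖ ^ 2 < m := hball (by rw [dist_eq_norm]; linarith)
  linarith [min_le_right η ((Qbar φ y).toReal - m)]

theorem ae_differentiableAt_of_locallyLipschitzOn {F : Rd d → ℝ} {U : Set (Rd d)} (hU : IsOpen U)
    (hF : LocallyLipschitzOn U F) : ∀ᵐ y, y ∈ U → DifferentiableAt ℝ F y := by
  have : volume {y | y ∈ U ∧ ¬ DifferentiableAt ℝ F y} = 0 := by
    refine measure_null_of_locally_null _ fun x hx => ?_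
    obtain ⟨K, t, ht, hK⟩ := hF hx.1
    rw [hU.nhdsWithin_eq hx.1] at ht
    obtain ⟨u, hut, hu, hxu⟩ := mem_nhds_iff.1 ht
    have hae := (hK.mono hut).ae_differentiableWithinAt_of_mem (μ := volume)
    refine ⟨{y | y ∈ u ∧ ¬ DifferentiableAt ℝ F y}, ?_, ?_⟩
    · filter_upwards [self_mem_nhdsWithin, nhdsWithin_le_nhds (hu.mem_nhds hxu)] with y h1 h2
      exact ⟨h2, h1.2⟩
    · refine measure_mono_null (fun y hy => ?_) hae
      exact fun h => hy.2 ((h hy.1).differentiableAt (hu.mem_nhds hy.1))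
  filter_upwards [compl_mem_ae_iff.2 this] with y hy hyU
  by_contra h
  exact hy ⟨hyU, h⟩

theorem ae_isDifferentiableAt {ν : Measure (Rd d)} (hν : ν ≪ volume) {φ : Rd d → ℝ}
    (hφ : ConvexOn ℝ univ φ) (hfin : ∀ᵐ y ∂ν, Qbar φ y ≠ ⊤) :
    ∀ᵐ y ∂ν, IsDifferentiableAt (legendre (potential φ)) y := by
  have hconv := convexOn_toReal_effDomain zero_le_one (uniformlyConvexWith_legendre_potential hφ)
    (legendre_ne_bot _)
  have h1 : ∀ᵐ y ∂ν, y ∉ frontier (effDomain (legendre (potential φ))) :=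
    hν.ae_le (compl_mem_ae_iff.2 (hconv.1.addHaar_frontier volume))
  have h2 := hν.ae_le
    (ae_differentiableAt_of_locallyLipschitzOn isOpen_interior hconv.locallyLipschitzOn_interior)
  filter_upwards [hfin, h1, h2] with y hy1 hy2 hy3
  have hmem : y ∈ interior (effDomain (legendre (potential φ))) := by
    by_contra h
    exact hy2 ⟨subset_closure (legendre_potential_ne_top hy1), h⟩
  exact ⟨hmem, hy3 hmem⟩

/-- `fderiv` is 0 at points of non-differentiability and measurable for every function, so the map
is measurable on the whole space. -/
theorem measurable_grad (f : Rd d → EReal) : Measurable (grad f) :=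
  (InnerProductSpace.toDual ℝ (Rd d)).symm.continuous.measurable.comp (measurable_fderiv ℝ _)

/-! ### Optimality in the dual problem -/

theorem dualFunctional_eq {μ ν : Measure (Rd d)} (hμ : MemP2 μ) {ψ : Rd d → ℝ} (hψ : ψ ∈ Cb2 d)
    (hi : QbarIntegrable ν ψ) :
    dualFunctional μ ν ψ = ((∫ x, ψ x ∂μ - ∫ y, (Qbar ψ y).toReal ∂ν : ℝ) : EReal) := by
  rw [dualFunctional, hi.extIntegral_eq,
    extIntegral_eq_integral (ae_of_all _ fun _ => rfl) (hμ.integrable_of_mem_Cb2 hψ), EReal.coe_sub]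

theorem dualFunctional_le_dualValue (μ ν : Measure (Rd d)) {ψ : Rd d → ℝ}
    (hc : ConvexOn ℝ univ ψ) (hψ : ψ ∈ Cb2 d) : dualFunctional μ ν ψ ≤ dualValue μ ν :=
  le_iSup₂ (f := fun ψ (_ : ψ ∈ {φ : Rd d → ℝ | (fun x => (φ x : EReal)) ∈ convexClass d ∧
    φ ∈ Sb2 d}) => dualFunctional μ ν ψ) ψ ⟨coe_mem_convexClass hc hψ.1, Cb2_subset_Sb2 hψ⟩

theorem IsForwardDualOptimizer.convexOn {μ ν : Measure (Rd d)} {φ : Rd d → ℝ}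
    (hφ : IsForwardDualOptimizer μ ν φ) : ConvexOn ℝ univ φ :=
  isConvex_coe_iff.1 hφ.1.2.1

/-- The competitor 0 makes the optimal value nonnegative. Since `Qbar φ ≥ φ` has integrable negative
part, an infinite positive part would make the value `-∞`. -/
theorem IsForwardDualOptimizer.qbarIntegrable {μ ν : Measure (Rd d)} (hμ : MemP2 μ)
    (hν : MemP2 ν) {φ : Rd d → ℝ} (hφ : IsForwardDualOptimizer μ ν φ) : QbarIntegrable ν φ := by
  have hφν := hν.integrable_of_mem_Cb2 hφ.2.1
  have h0 : 0 ≤ dualFunctional μ ν φ := by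
    rw [hφ.2.2]
    refine le_trans (le_of_eq ?_)
      (dualFunctional_le_dualValue μ ν (convexOn_const 0 convex_univ) mem_Cb2_zero)
    rw [dualFunctional_eq hμ mem_Cb2_zero (qbarIntegrable_zero ν)]
    simp [Qbar_zero]
  have hneg : ∫⁻ y, (-Qbar φ y).toENNReal ∂ν ≠ ⊤ := by
    refine ne_top_of_le_ne_top hφν.neg.lintegral_lt_top.ne (lintegral_mono fun y => ?_)
    rw [← EReal.real_coe_toENNReal]
    refine EReal.toENNReal_le_toENNReal ?_
    have : (φ y : EReal) ≤ Qbar φ y :=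
      (le_of_eq (by simp)).trans (le_iSup (fun x => ((φ x - ‖x - y‖ ^ 2 : ℝ) : EReal)) y)
    simpa using EReal.neg_le_neg_iff.2 this
  have hpos : ∫⁻ y, (Qbar φ y).toENNReal ∂ν ≠ ⊤ := by
    intro htop
    rw [dualFunctional, extIntegral_eq_integral (ae_of_all _ fun _ => rfl)
      (hμ.integrable_of_mem_Cb2 hφ.2.1), extIntegral, htop] at h0
    rw [EReal.coe_ennreal_top, EReal.top_sub (by simpa using hneg), EReal.sub_top] at h0
    exact absurd h0 (by simp)
  have hmeas : Measurable fun y => (Qbar φ y).toENNReal := measurable_Qbar.ereal_toENNReal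
  refine qbarIntegrable_of_le hφν (integrable_toReal_of_lintegral_ne_top hmeas.aemeasurable hpos)
    ?_ (fun _ => le_rfl)
  filter_upwards [ae_lt_top hmeas hpos] with y hy x
  have hfin : Qbar φ y ≠ ⊤ := fun h => by simp [h] at hy
  refine (sub_le_toReal_Qbar hfin x).trans ?_
  rw [← EReal.coe_toReal hfin (Qbar_ne_bot _ _), EReal.real_coe_toENNReal, EReal.toReal_coe]
  rw [ENNReal.toReal_ofReal']
  exact le_max_left _ _

theorem IsForwardDualOptimizer.le {μ ν : Measure (Rd d)} (hμ : MemP2 μ) (hν : MemP2 ν)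
    {φ : Rd d → ℝ} (hφ : IsForwardDualOptimizer μ ν φ) {ψ : Rd d → ℝ} (hc : ConvexOn ℝ univ ψ)
    (hψ : ψ ∈ Cb2 d) (hi : QbarIntegrable ν ψ) :
    ∫ x, ψ x ∂μ - ∫ y, (Qbar ψ y).toReal ∂ν ≤ ∫ x, φ x ∂μ - ∫ y, (Qbar φ y).toReal ∂ν := by
  have := dualFunctional_le_dualValue μ ν hc hψ
  rw [← hφ.2.2, dualFunctional_eq hμ hψ hi,
    dualFunctional_eq hμ hφ.2.1 (hφ.qbarIntegrable hμ hν)] at this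
  exact_mod_cast this

/-- The first-order optimality condition in the dual problem. -/
theorem IsForwardDualOptimizer.first_order {μ ν : Measure (Rd d)} (hμ : MemP2 μ) (hν : MemP2 ν)
    {φ : Rd d → ℝ} (hφ : IsForwardDualOptimizer μ ν φ) {T : Rd d → Rd d} (hT : Measurable T)
    (hwp : ∀ᵐ y ∂ν, WellPosedAt φ y (T y)) {ψ : Rd d → ℝ} (hc : ConvexOn ℝ univ ψ)
    (hψ : ψ ∈ Cb2 d) (hi : QbarIntegrable ν ψ) :
    Integrable (fun y => ψ (T y) - φ (T y)) ν ∧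
      ∫ x, ψ x ∂μ - ∫ x, φ x ∂μ ≤ ∫ y, (ψ (T y) - φ (T y)) ∂ν := by
  have hφi := hφ.qbarIntegrable hμ hν
  refine le_integral_of_forall_le_integral_Qbar hν hφ.2.1 hψ hφi hi hT hwp fun ε h0 h1 => ?_
  have := hφ.le hμ hν (ψ := fun x => (1 - ε) * φ x + ε * ψ x)
    ((hφ.convexOn.smul (sub_nonneg.2 h1.le)).add (hc.smul h0.le))
    (mem_Cb2_add (mem_Cb2_const_mul hφ.2.1 _) (mem_Cb2_const_mul hψ _))
    (QbarIntegrable.convexCombination hν hφ.2.1 hψ hφi hi h0.le h1.le)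
  rw [integral_add ((hμ.integrable_of_mem_Cb2 hφ.2.1).const_mul _)
    ((hμ.integrable_of_mem_Cb2 hψ).const_mul _), integral_const_mul, integral_const_mul] at this
  linarith

/-! ### Weak duality -/

/-- Integrate `ψ x - Qbar ψ y ≤ |x - y|²` against a coupling. Convexity of `ψ` plays no role, which
the uniqueness argument exploits. -/
theorem ofReal_le_transportCost {η ν : Measure (Rd d)} (hη : MemP2 η) {ψ : Rd d → ℝ}
    (hψ : ψ ∈ Cb2 d) (hi : QbarIntegrable ν ψ) :
    ENNReal.ofReal (∫ x, ψ x ∂η - ∫ y, (Qbar ψ y).toReal ∂ν) ≤ transportCost η ν := by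
  refine le_iInf₂ fun π hπ => ?_
  obtain ⟨rfl, rfl⟩ := hπ
  by_cases htop : ∫⁻ p, ‖p.1 - p.2‖ₑ ^ 2 ∂π = ⊤
  · rw [htop]; exact le_top
  have hcost : Integrable (fun p : Rd d × Rd d => ‖p.1 - p.2‖ ^ 2) π := by
    refine ⟨by fun_prop, ?_⟩
    rw [hasFiniteIntegral_iff_enorm]
    simpa [enorm_pow] using lt_top_iff_ne_top.2 htop
  have e1 : ∫⁻ p, ‖p.1 - p.2‖ₑ ^ 2 ∂π = ENNReal.ofReal (∫ p, ‖p.1 - p.2‖ ^ 2 ∂π) := by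
    rw [ofReal_integral_eq_lintegral_ofReal hcost (ae_of_all _ fun _ => by positivity)]
    refine lintegral_congr fun p => ?_
    rw [ENNReal.ofReal_pow (norm_nonneg _), ofReal_norm]
  have hψi := hη.integrable_of_mem_Cb2 hψ
  have i1 : Integrable (fun p : Rd d × Rd d => ψ p.1) π := hψi.comp_measurable measurable_fst
  have i2 : Integrable (fun p : Rd d × Rd d => (Qbar ψ p.2).toReal) π :=
    hi.2.comp_measurable measurable_snd
  have e2 : ∫ x, ψ x ∂π.fst = ∫ p, ψ p.1 ∂π :=
    integral_map measurable_fst.aemeasurable hψi.aestronglyMeasurable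
  have e3 : ∫ y, (Qbar ψ y).toReal ∂π.snd = ∫ p, (Qbar ψ p.2).toReal ∂π :=
    integral_map measurable_snd.aemeasurable hi.2.aestronglyMeasurable
  have hae : ∀ᵐ p ∂π, Qbar ψ p.2 ≠ ⊤ := ae_of_ae_map measurable_snd.aemeasurable hi.1
  rw [e1, e2, e3, ← integral_sub i1 i2]
  refine ENNReal.ofReal_le_ofReal (integral_mono_ae (i1.sub i2) hcost (hae.mono fun p hp => ?_))
  have := sub_le_toReal_Qbar hp p.1
  simp only
  linarith

theorem transportCost_map_le {ν : Measure (Rd d)} {T : Rd d → Rd d} (hT : Measurable T)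
    (h : Integrable (fun y => ‖T y - y‖ ^ 2) ν) :
    transportCost (ν.map T) ν ≤ ENNReal.ofReal (∫ y, ‖T y - y‖ ^ 2 ∂ν) := by
  have hm : Measurable fun y => (T y, y) := hT.prodMk measurable_id
  have hmem : ν.map (fun y => (T y, y)) ∈ couplings (ν.map T) ν := by
    constructor
    · exact Measure.map_map measurable_fst hm
    · exact (Measure.map_map measurable_snd hm).trans Measure.map_id
  refine (iInf₂_le _ hmem).trans (le_of_eq ?_)
  rw [lintegral_map (by fun_prop) hm,
    ofReal_integral_eq_lintegral_ofReal h (ae_of_all _ fun _ => by positivity)]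
  refine lintegral_congr fun y => ?_
  rw [ENNReal.ofReal_pow (norm_nonneg _), ofReal_norm]

theorem ConvexOrderLE.integral_le {μ ξ : Measure (Rd d)} (h : ConvexOrderLE μ ξ) {u : Rd d → ℝ}
    (hc : ConvexOn ℝ univ u) (hμ : Integrable u μ) (hξ : Integrable u ξ) :
    ∫ x, u x ∂μ ≤ ∫ x, u x ∂ξ := by
  have := h u hc (extIntegralExists_coe hμ) (extIntegralExists_coe hξ)
  rw [extIntegral_eq_integral (ae_of_all _ fun _ => rfl) hμ,
    extIntegral_eq_integral (ae_of_all _ fun _ => rfl) hξ] at this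
  exact_mod_cast this

/-! ### Reduction of the convex order to Lipschitz convex functions -/

/-- A convex function is a countable supremum of affine ones; `H n` is the maximum of the first `n +
1`. Convexity of `-H 0` records that `H 0` is affine. -/
theorem exists_monotone_lipschitz_convex_approx {h : Rd d → ℝ} (hh : ConvexOn ℝ univ h) :
    ∃ H : ℕ → Rd d → ℝ, (∀ n, ConvexOn ℝ univ (H n) ∧ ∃ K, LipschitzWith K (H n)) ∧
      ConvexOn ℝ univ (fun x => -H 0 x) ∧ Monotone H ∧ (∀ n, H n ≤ h) ∧
      ∀ x, Tendsto (fun n => H n x) atTop (𝓝 (h x)) := by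
  have hcont : Continuous h := hh.locallyLipschitz.continuous
  obtain ⟨l, c, hle, hsup⟩ := hh.real_univ_sSup_of_nat_affine_eq hcont.lowerSemicontinuous
  set a : ℕ → Rd d → ℝ := fun i => ⇑(l i) + Function.const (Rd d) (c i) with ha
  have hac : ∀ i, ConvexOn ℝ univ (a i) := fun i =>
    ((l i).toLinearMap.convexOn convex_univ).add (convexOn_const _ convex_univ)
  have haL : ∀ i, ∃ K, LipschitzWith K (a i) := fun i =>
    ⟨_, (l i).lipschitz.add (LipschitzWith.const (c i))⟩
  refine ⟨partialSups a, fun n => ?_, ?_, (partialSups a).monotone,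
    fun n => partialSups_le _ _ _ fun i _ => hle i, fun x => ?_⟩
  · induction n with
    | zero => exact ⟨by simpa using hac 0, by simpa using haL 0⟩
    | succ n ih =>
      obtain ⟨h1, K, hK⟩ := ih
      obtain ⟨K', hK'⟩ := haL (n + 1)
      rw [partialSups_add_one]
      exact ⟨h1.sup (hac _), _, hK.max hK'⟩
  · simp only [partialSups_zero]
    exact (((l 0).toLinearMap.concaveOn convex_univ).add (concaveOn_const _ convex_univ)).neg
  · refine tendsto_atTop_isLUB (fun m n hmn => (partialSups a).monotone hmn x) ⟨?_, fun b hb => ?_⟩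
    · rintro _ ⟨n, rfl⟩
      exact partialSups_le a n h (fun i _ => hle i) x
    · have := congrFun hsup x
      rw [← this, iSup_apply]
      exact ciSup_le fun i => (le_partialSups a i x).trans (hb (mem_range_self i))

theorem convexOrderLE_of_lipschitz {μ ξ : Measure (Rd d)} (hμ : MemP2 μ) (hξ : MemP2 ξ)
    (H : ∀ (h : Rd d → ℝ) (K : NNReal), ConvexOn ℝ univ h → LipschitzWith K h →
      ∫ x, h x ∂μ ≤ ∫ x, h x ∂ξ) : ConvexOrderLE μ ξ := by
  intro h hh _ _
  have hcont : Continuous h := hh.locallyLipschitz.continuous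
  obtain ⟨a, ha, ha0, hmono, hle, hlim⟩ := exists_monotone_lipschitz_convex_approx hh
  have hint : ∀ {m : Measure (Rd d)}, MemP2 m → ∀ n, Integrable (a n) m := fun hm n =>
    hm.integrable_of_mem_Cb2 (mem_Cb2_of_lipschitz (ha n).2.choose_spec)
  have hsub : ∀ {m : Measure (Rd d)}, MemP2 m → ∀ n, Integrable (fun x => a n x - a 0 x) m :=
    fun hm n => (hint hm n).sub (hint hm 0)
  have hreal : ∀ n, ∫ x, a n x ∂μ ≤ ∫ x, a n x ∂ξ := fun n =>
    H _ _ (ha n).1 (ha n).2.choose_spec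
  -- Both `a 0` and `-a 0` are admissible, so subtracting `a 0` is harmless and leaves nonnegative
  -- functions to which Fatou applies.
  have h0 : ∫ x, a 0 x ∂μ = ∫ x, a 0 x ∂ξ := by
    refine le_antisymm (hreal 0) ?_
    have := H _ _ ha0 (ha 0).2.choose_spec.neg
    rw [integral_neg, integral_neg] at this
    linarith
  have hpos : ∀ n x, 0 ≤ a n x - a 0 x := fun n x => sub_nonneg.2 (hmono (Nat.zero_le n) x)
  have hlint : ∫⁻ x, ENNReal.ofReal (h x - a 0 x) ∂μ ≤ ∫⁻ x, ENNReal.ofReal (h x - a 0 x) ∂ξ := by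
    calc ∫⁻ x, ENNReal.ofReal (h x - a 0 x) ∂μ
        = ∫⁻ x, liminf (fun n => ENNReal.ofReal (a n x - a 0 x)) atTop ∂μ :=
          lintegral_congr fun x => (ENNReal.tendsto_ofReal
            ((hlim x).sub_const (a 0 x))).liminf_eq.symm
      _ ≤ liminf (fun n => ∫⁻ x, ENNReal.ofReal (a n x - a 0 x) ∂μ) atTop :=
          lintegral_liminf_le' fun n =>
            (hsub hμ n).aestronglyMeasurable.aemeasurable.ennreal_ofReal
      _ ≤ liminf (fun _ : ℕ => ∫⁻ x, ENNReal.ofReal (h x - a 0 x) ∂ξ) atTop := by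
          refine liminf_le_liminf (Eventually.of_forall fun n => ?_)
          calc ∫⁻ x, ENNReal.ofReal (a n x - a 0 x) ∂μ
              ≤ ∫⁻ x, ENNReal.ofReal (a n x - a 0 x) ∂ξ := by
                rw [← ofReal_integral_eq_lintegral_ofReal (hsub hμ n)
                    (ae_of_all _ (hpos n)),
                  ← ofReal_integral_eq_lintegral_ofReal (hsub hξ n)
                    (ae_of_all _ (hpos n)), integral_sub (hint hμ n) (hint hμ 0),
                  integral_sub (hint hξ n) (hint hξ 0)]
                exact ENNReal.ofReal_le_ofReal (by linarith [hreal n])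
            _ ≤ _ := lintegral_mono fun x => ENNReal.ofReal_le_ofReal (by linarith [hle n x])
      _ = _ := by simp
  have hnn : ∀ x, 0 ≤ h x - a 0 x := fun x => sub_nonneg.2 (hle 0 x)
  -- As `a 0` is integrable, an infinite integral here puts all the divergence in the positive part
  -- of `h`, and the right-hand side is `⊤`.
  by_cases htop : ∫⁻ x, ENNReal.ofReal (h x - a 0 x) ∂ξ = ⊤
  · have hpos' : ∫⁻ x, ENNReal.ofReal (h x) ∂ξ = ⊤ := by
      by_contra hfin
      have hb : ∫⁻ x, ENNReal.ofReal (h x - a 0 x) ∂ξ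
          ≤ ∫⁻ x, (ENNReal.ofReal (h x) + ENNReal.ofReal (-a 0 x)) ∂ξ :=
        lintegral_mono fun x => by
          rw [sub_eq_add_neg]; exact ENNReal.ofReal_add_le
      rw [htop, lintegral_add_left hcont.measurable.ennreal_ofReal, top_le_iff,
        ENNReal.add_eq_top] at hb
      exact hb.elim hfin ((hint hξ 0).neg.lintegral_lt_top.ne)
    have hneg : ∫⁻ x, ENNReal.ofReal (-h x) ∂ξ ≠ ⊤ :=
      ne_top_of_le_ne_top ((hint hξ 0).neg.lintegral_lt_top.ne)
        (lintegral_mono fun x => ENNReal.ofReal_le_ofReal (neg_le_neg (hle 0 x)))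
    have : extIntegral ξ (fun x => (h x : EReal)) = ⊤ := by
      simp only [extIntegral, ← EReal.coe_neg, EReal.real_coe_toENNReal, hpos']
      rw [EReal.coe_ennreal_top, EReal.top_sub (by simpa using hneg)]
    rw [this]
    exact le_top
  · have hi : ∀ {m : Measure (Rd d)}, MemP2 m →
        ∫⁻ x, ENNReal.ofReal (h x - a 0 x) ∂m ≠ ⊤ →
        Integrable (fun x => h x - a 0 x) m ∧ Integrable h m := by
      intro m hm hfin
      have h1 : Integrable (fun x => h x - a 0 x) m := by
        refine ⟨hcont.aestronglyMeasurable.sub (hint hm 0).aestronglyMeasurable, ?_⟩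
        rw [hasFiniteIntegral_iff_ofReal (ae_of_all _ hnn)]
        exact lt_top_iff_ne_top.2 hfin
      exact ⟨h1, (h1.add (hint hm 0)).congr (ae_of_all _ fun x => by simp)⟩
    obtain ⟨i1, i2⟩ := hi hξ htop
    obtain ⟨j1, j2⟩ := hi hμ (ne_top_of_le_ne_top htop hlint)
    rw [extIntegral_eq_integral (ae_of_all _ fun _ => rfl) j2,
      extIntegral_eq_integral (ae_of_all _ fun _ => rfl) i2]
    rw [← ofReal_integral_eq_lintegral_ofReal j1 (ae_of_all _ hnn),
      ← ofReal_integral_eq_lintegral_ofReal i1 (ae_of_all _ hnn),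
      ENNReal.ofReal_le_ofReal_iff (integral_nonneg hnn), integral_sub j2 (hint hμ 0),
      integral_sub i2 (hint hξ 0), h0] at hlint
    exact_mod_cast (by linarith : ∫ x, h x ∂μ ≤ ∫ x, h x ∂ξ)

/-! ### The projection -/

section Projection

variable {μ ν : Measure (Rd d)} {φ : Rd d → ℝ} {T : Rd d → Rd d}

theorem IsForwardDualOptimizer.integral_comp_le (hμ : MemP2 μ) (hν : MemP2 ν)
    (hφ : IsForwardDualOptimizer μ ν φ) (hT : Measurable T)
    (hwp : ∀ᵐ y ∂ν, WellPosedAt φ y (T y)) :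
    Integrable (fun y => φ (T y)) ν ∧ ∫ y, φ (T y) ∂ν ≤ ∫ x, φ x ∂μ := by
  obtain ⟨h1, h2⟩ := hφ.first_order hμ hν hT hwp (convexOn_const 0 convex_univ) mem_Cb2_zero
    (qbarIntegrable_zero ν)
  simp only [zero_sub, integral_neg, integral_zero] at h1 h2
  exact ⟨by simpa using h1.neg, by linarith⟩

theorem IsForwardDualOptimizer.transport_integrable (hμ : MemP2 μ) (hν : MemP2 ν)
    (hφ : IsForwardDualOptimizer μ ν φ) (hT : Measurable T)
    (hwp : ∀ᵐ y ∂ν, WellPosedAt φ y (T y)) :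
    Integrable (fun y => ‖T y - y‖ ^ 2) ν ∧
      ∫ y, ‖T y - y‖ ^ 2 ∂ν ≤ ∫ x, φ x ∂μ - ∫ y, (Qbar φ y).toReal ∂ν := by
  obtain ⟨h1, h2⟩ := hφ.integral_comp_le hμ hν hT hwp
  have hq := (hφ.qbarIntegrable hμ hν).2
  have hae : (fun y => φ (T y) - (Qbar φ y).toReal) =ᵐ[ν] fun y => ‖T y - y‖ ^ 2 :=
    hwp.mono fun y hy => by
      simp only
      linarith [hy.eq]
  refine ⟨(h1.sub hq).congr hae, ?_⟩
  rw [← integral_congr_ae hae, integral_sub h1 hq]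
  linarith

theorem IsForwardDualOptimizer.memP2_map (hμ : MemP2 μ) (hν : MemP2 ν)
    (hφ : IsForwardDualOptimizer μ ν φ) (hT : Measurable T)
    (hwp : ∀ᵐ y ∂ν, WellPosedAt φ y (T y)) : MemP2 (ν.map T) := by
  have := hν.1
  have := Measure.isProbabilityMeasure_map (μ := ν) hT.aemeasurable
  refine memP2_of_integrable_norm_sq ?_
  rw [integrable_map_measure (by fun_prop) hT.aemeasurable]
  refine (((hφ.transport_integrable hμ hν hT hwp).1.add hν.integrable_norm_sq).const_mul 2).mono'
    (by fun_prop) (ae_of_all _ fun y => ?_)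
  have h1 : ‖T y‖ ≤ ‖T y - y‖ + ‖y‖ := by simpa using norm_add_le (T y - y) y
  simp only [Function.comp_apply, norm_pow, norm_norm, Pi.add_apply]
  nlinarith [sq_nonneg (‖T y - y‖ - ‖y‖), norm_nonneg (T y)]

theorem IsForwardDualOptimizer.integral_le_of_lipschitz (hμ : MemP2 μ) (hν : MemP2 ν)
    (hφ : IsForwardDualOptimizer μ ν φ) (hT : Measurable T)
    (hwp : ∀ᵐ y ∂ν, WellPosedAt φ y (T y)) {h : Rd d → ℝ} {K : NNReal}
    (hc : ConvexOn ℝ univ h) (hh : LipschitzWith K h) : ∫ x, h x ∂μ ≤ ∫ y, h (T y) ∂ν := by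
  have hCb := mem_Cb2_of_lipschitz hh
  have hi : Integrable (fun y => h (T y)) ν :=
    ((hφ.memP2_map hμ hν hT hwp).integrable_of_mem_Cb2 hCb).comp_measurable hT
  have hφT := (hφ.integral_comp_le hμ hν hT hwp).1
  by_contra! hlt
  set b := ∫ x, φ x ∂μ - ∫ y, φ (T y) ∂ν with hb
  -- First-order optimality with `ψ = r h` bounds `r` times the positive gap by `b`; this `r` makes
  -- the product `|b| + 1`.
  set r := (|b| + 1) / (∫ x, h x ∂μ - ∫ y, h (T y) ∂ν) with hr
  have hr0 : 0 ≤ r := div_nonneg (by positivity) (by linarith)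
  have h1 := (hφ.first_order hμ hν hT hwp (ψ := fun x => r * h x) (hc.smul hr0)
    (mem_Cb2_const_mul hCb r)
    (qbarIntegrable_of_lipschitz hν ((lipschitzWith_smul r).comp hh))).2
  rw [integral_const_mul, integral_sub (hi.const_mul r) hφT, integral_const_mul] at h1
  have h2 : r * (∫ x, h x ∂μ - ∫ y, h (T y) ∂ν) = |b| + 1 :=
    div_mul_cancel₀ _ (by linarith)
  linarith [le_abs_self b]

theorem IsForwardDualOptimizer.map_mem_forwardCone (hμ : MemP2 μ) (hν : MemP2 ν)
    (hφ : IsForwardDualOptimizer μ ν φ) (hT : Measurable T)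
    (hwp : ∀ᵐ y ∂ν, WellPosedAt φ y (T y)) : ν.map T ∈ forwardCone μ := by
  have hP := hφ.memP2_map hμ hν hT hwp
  refine ⟨hP, convexOrderLE_of_lipschitz hμ hP fun h K hc hh => ?_⟩
  rw [integral_map hT.aemeasurable hh.continuous.aestronglyMeasurable]
  exact hφ.integral_le_of_lipschitz hμ hν hT hwp hc hh

theorem IsForwardDualOptimizer.ofReal_le_transportCost_of_mem (hμ : MemP2 μ) (hν : MemP2 ν)
    (hφ : IsForwardDualOptimizer μ ν φ) {η : Measure (Rd d)} (hη : η ∈ forwardCone μ) :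
    ENNReal.ofReal (∫ x, φ x ∂μ - ∫ y, (Qbar φ y).toReal ∂ν) ≤ transportCost η ν := by
  refine le_trans (ENNReal.ofReal_le_ofReal (sub_le_sub_right ?_ _))
    (ofReal_le_transportCost hη.1 hφ.2.1 (hφ.qbarIntegrable hμ hν))
  exact hη.2.integral_le hφ.convexOn (hμ.integrable_of_mem_Cb2 hφ.2.1)
    (hη.1.integrable_of_mem_Cb2 hφ.2.1)

theorem IsForwardDualOptimizer.transportCost_map_le (hμ : MemP2 μ) (hν : MemP2 ν)
    (hφ : IsForwardDualOptimizer μ ν φ) (hT : Measurable T)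
    (hwp : ∀ᵐ y ∂ν, WellPosedAt φ y (T y)) : transportCost (ν.map T) ν
      ≤ ENNReal.ofReal (∫ x, φ x ∂μ - ∫ y, (Qbar φ y).toReal ∂ν) := by
  obtain ⟨h1, h2⟩ := hφ.transport_integrable hμ hν hT hwp
  exact (ConvexOrderProjection.transportCost_map_le hT h1).trans (ENNReal.ofReal_le_ofReal h2)

/-- The dual value bounds the cost of `T` from above and the cost of every element of the cone from
below. -/
theorem IsForwardDualOptimizer.isForwardProjection_map (hμ : MemP2 μ) (hν : MemP2 ν)
    (hφ : IsForwardDualOptimizer μ ν φ) (hT : Measurable T)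
    (hwp : ∀ᵐ y ∂ν, WellPosedAt φ y (T y)) : IsForwardProjection μ ν (ν.map T) :=
  have hmem := hφ.map_mem_forwardCone hμ hν hT hwp
  ⟨hmem, le_antisymm (le_iInf₂ fun _ hη => (hφ.transportCost_map_le hμ hν hT hwp).trans
    (hφ.ofReal_le_transportCost_of_mem hμ hν hη)) (iInf₂_le _ hmem)⟩

/-- Weak duality for `ξ` with potential `φ + ε h`, together with `∫ φ dμ ≤ ∫ φ dξ` and the optimal
cost of `ξ`, gives the hypothesis of the envelope inequality with `c = ∫ h dξ`. -/
theorem IsForwardDualOptimizer.integral_le_of_isForwardProjection (hμ : MemP2 μ) (hν : MemP2 ν)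
    (hφ : IsForwardDualOptimizer μ ν φ) (hT : Measurable T)
    (hwp : ∀ᵐ y ∂ν, WellPosedAt φ y (T y)) {ξ : Measure (Rd d)}
    (hξ : IsForwardProjection μ ν ξ) {h : Rd d → ℝ} (hc : Continuous h) {M : ℝ}
    (hM : ∀ x, |h x| ≤ M) : ∫ x, h x ∂ξ ≤ ∫ y, h (T y) ∂ν := by
  have hφi := hφ.qbarIntegrable hμ hν
  have hCb : h ∈ Cb2 d := by
    refine ⟨hc, M, fun x => (hM x).trans ?_⟩
    have hM0 : 0 ≤ M := (abs_nonneg _).trans (hM x)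
    nlinarith [mul_nonneg hM0 (sq_nonneg ‖x‖)]
  have hCb' : (fun x => φ x + h x) ∈ Cb2 d := mem_Cb2_add hφ.2.1 hCb
  have hi' := hφi.add_bounded hν hφ.2.1 hM
  -- Nonnegativity of the dual value lets `ENNReal.ofReal` be removed from the cost comparison.
  have hD : 0 ≤ ∫ x, φ x ∂μ - ∫ y, (Qbar φ y).toReal ∂ν := by
    have := hφ.le hμ hν (convexOn_const 0 convex_univ) mem_Cb2_zero (qbarIntegrable_zero ν)
    simpa [Qbar_zero] using this
  have hcost : transportCost ξ ν
      ≤ ENNReal.ofReal (∫ x, φ x ∂μ - ∫ y, (Qbar φ y).toReal ∂ν) := by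
    rw [hξ.2, ← (hφ.isForwardProjection_map hμ hν hT hwp).2]
    exact hφ.transportCost_map_le hμ hν hT hwp
  have hφξ := hξ.1.1.integrable_of_mem_Cb2 hφ.2.1
  have hhξ := hξ.1.1.integrable_of_mem_Cb2 hCb
  have hle := hξ.1.2.integral_le hφ.convexOn (hμ.integrable_of_mem_Cb2 hφ.2.1) hφξ
  have key := (le_integral_of_forall_le_integral_Qbar hν hφ.2.1 hCb' hφi hi' hT hwp
    (c := ∫ x, h x ∂ξ) fun ε h0 h1 => ?_).2
  · simpa using key
  have hw := (ofReal_le_transportCost hξ.1.1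
    (mem_Cb2_add (mem_Cb2_const_mul hφ.2.1 (1 - ε)) (mem_Cb2_const_mul hCb' ε))
    (QbarIntegrable.convexCombination hν hφ.2.1 hCb' hφi hi' h0.le h1.le)).trans hcost
  rw [ENNReal.ofReal_le_ofReal_iff hD] at hw
  have e : ∫ x, ((1 - ε) * φ x + ε * (φ x + h x)) ∂ξ = ∫ x, φ x ∂ξ + ε * ∫ x, h x ∂ξ := by
    rw [← integral_const_mul, ← integral_add hφξ (hhξ.const_mul ε)]
    congr 1
    ext x
    ring
  rw [e] at hw
  linarith

theorem IsForwardDualOptimizer.eq_map_of_isForwardProjection (hμ : MemP2 μ) (hν : MemP2 ν)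
    (hφ : IsForwardDualOptimizer μ ν φ) (hT : Measurable T)
    (hwp : ∀ᵐ y ∂ν, WellPosedAt φ y (T y)) {ξ : Measure (Rd d)}
    (hξ : IsForwardProjection μ ν ξ) : ξ = ν.map T := by
  have := hν.1
  have := hξ.1.1.1
  have := Measure.isProbabilityMeasure_map (μ := ν) hT.aemeasurable
  refine ext_of_forall_integral_eq_of_IsFiniteMeasure fun h => ?_
  rw [integral_map hT.aemeasurable h.continuous.aestronglyMeasurable]
  refine le_antisymm (hφ.integral_le_of_isForwardProjection hμ hν hT hwp hξ h.continuous
    (M := ‖h‖) h.norm_coe_le_norm) ?_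
  have := hφ.integral_le_of_isForwardProjection hμ hν hT hwp hξ (h := fun x => -h x)
    h.continuous.neg (M := ‖h‖) (fun x => by rw [abs_neg]; exact h.norm_coe_le_norm x)
  rw [integral_neg, integral_neg] at this
  linarith

end Projection

end ConvexOrderProjection

theorem mainTheorem4 {d : ℕ} (μ ν : Measure (Rd d)) (hμ : MemP2 μ) (hν : MemP2ac ν)
    (φ : Rd d → ℝ) (hφ : IsForwardDualOptimizer μ ν φ) :
    (IsConvexExpansion (legendre (potential φ)) ∧
      HessianGEId (interior (effDomain (legendre (potential φ))))
        (fun y => (legendre (potential φ) y).toReal) ∧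
      UniformlyConvexWith 1 (legendre (potential φ))) ∧
    ((∀ᵐ y ∂ν, IsDifferentiableAt (legendre (potential φ)) y) ∧
      IsForwardProjection μ ν (ν.map (grad (legendre (potential φ)))) ∧
      ∀ ξ : Measure (Rd d), IsForwardProjection μ ν ξ →
        ξ = ν.map (grad (legendre (potential φ)))) := by
  have := hν.1.1
  have hconv := hφ.convexOn
  have huc := uniformlyConvexWith_legendre_potential hconv
  have hfin := (hφ.qbarIntegrable hμ hν.1).1
  have hdiff := ae_isDifferentiableAt hν.2 hconv hfin
  have hwp := hdiff.mono fun y hy => hy.wellPosedAt hφ.2.1.1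
  have hT := measurable_grad (legendre (potential φ))
  -- A ν-full set is nonempty because ν is a probability measure; one point of finiteness gives
  -- properness.
  obtain ⟨y, hy⟩ := hfin.exists
  exact ⟨⟨isConvexExpansion_legendre_potential hconv hφ.2.1.1 ⟨y, legendre_potential_ne_top hy⟩,
      hessianGEId_toReal huc (legendre_ne_bot _), huc⟩, hdiff,
    hφ.isForwardProjection_map hμ hν.1 hT hwp,
    fun ξ hξ => hφ.eq_map_of_isForwardProjection hμ hν.1 hT hwp hξ⟩
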